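/- For $\sigma>0$ let $\mathcal B_\sigma=\{f\in L^2(\mathbb R):\ \operatorname{supp}\widehat f\subseteq[-\tfrac{\sigma}{2\pi},\tfrac{\sigma}{2\pi}]\}$, where $\widehat f(w)=\int_{\mathbb R} f(x)e^{-2\pi i x w}\,dx$ (extended to $L^2(\mathbb R)$ by Plancherel), and for $x,y\in\mathbb R$ let $T_xf(t)=f(t-x)$ and $M_yf(t)=e^{2\pi i y t}f(t)$. For an integer $k\ge 1$ let $c_k$ be the smallest eigenvalue $\lambda$ of the boundary value problem $(-1)^k u^{(2k)}=\lambda u$ on $[0,1]$, $u^{(l)}(0)=u^{(l)}(1)=0$ for $0\le l\le k-1$, $0\ne u\in C^{2k}[0,1]$. A family $(f_n)$ in a Hilbert space $\mathcal H$ is a frame for $\mathcal H$ if there are constants $0<m\le M<\infty$ with $m\|f\|^2\le\sum_n|\langle f,f_n\rangle|^2\le M\|f\|^2$ for all $f\in\mathcal H$. Theorem. Let $\sigma>0$, let $k,\nu\ge1$ be integers, and let $g\in\mathcal B_\sigma\cap L^1(\mathbb R)$, where $g$ denotes the continuous representative of its class. Let $(y_j)_{j\in\mathbb Z}$ be real numbers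 for which there are constants $a,b>0$ such that $$a\le\sum_{j\in\mathbb Z}|\widehat g(\xi-y_j)|^2\le b\qquad\text{for all }\xi\in\mathbb R .$$ For each $j\in\mathbb Z$ let $(x_{i,j})_{i\in\mathbb Z}$ be a strictly increasing sequence of real numbers, and suppose that there are constants $\gamma>0$ and $\delta_\nu$, both independent of $j$, such that $|x_{i,j}-x_{i',j}|\ge\gamma$ for all $i\ne i'$ and all $j$, and $$x_{i+\nu,j}-x_{i,j}\le\delta_\nu\ \text{ for all } i,j\in\mathbb Z,\qquad \delta_\nu<\frac{\nu}{\sigma}\,c_k^{1/(2k)} .$$ Then $g$ is infinitely differentiable, the functions $M_{y_j}T_{x_{i,j}}g^{(l)}$ belong to $L^2(\mathbb R)$ for $0\le l\le k-1$ and $i,j\in\mathbb Z$, and the family $\{M_{y_j}T_{x_{i,j}}g^{(l)}:\ l=0,1,\dots,k-1,\ i,j\in\mathbb Z\}$ is a frame for $L^2(\mathbb R)$. -/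

import Mathlib

open MeasureTheory
open scoped FourierTransform ContDiff

noncomputable section

/-- The space `B_σ` of `σ`-bandlimited functions: the `f ∈ L²(ℝ)` whose (Plancherel) Fourier
transform, with kernel `exp (-2πixw)`, is supported in `[-σ/(2π), σ/(2π)]`. -/
def bandlimited (σ : ℝ) : Set (Lp ℂ 2 (volume : Measure ℝ)) :=
  {f | ∀ᵐ w : ℝ, w ∉ Set.Icc (-(σ / (2 * Real.pi))) (σ / (2 * Real.pi)) →
    (𝓕 f : Lp ℂ 2 (volume : Measure ℝ)) w = 0}

/-- The translation `(T_x f)(t) = f (t - x)`. -/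
def translation (x : ℝ) (f : ℝ → ℂ) : ℝ → ℂ := fun t => f (t - x)

/-- The modulation `(M_y f)(t) = exp (2πiyt) f(t)`. -/
def modulation (y : ℝ) (f : ℝ → ℂ) : ℝ → ℂ :=
  fun t => Complex.exp (2 * Real.pi * Complex.I * y * t) * f t

/-- `F` is a frame for the Hilbert space `H`: there are constants `0 < m ≤ M < ∞` with
`m ‖f‖² ≤ ∑ |⟨f, F n⟩|² ≤ M ‖f‖²` for every `f`. -/
def IsFrame {ι H : Type*} [NormedAddCommGroup H] [InnerProductSpace ℂ H] (F : ι → H) : Prop :=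
  ∃ m M : ℝ, 0 < m ∧ m ≤ M ∧ ∀ f : H,
    Summable (fun n => ‖(inner ℂ (F n) f : ℂ)‖ ^ 2) ∧
    m * ‖f‖ ^ 2 ≤ ∑' n, ‖(inner ℂ (F n) f : ℂ)‖ ^ 2 ∧
    ∑' n, ‖(inner ℂ (F n) f : ℂ)‖ ^ 2 ≤ M * ‖f‖ ^ 2

/-- The sequence `x` is separated by the constant `γ`: distinct indices give points at distance
at least `γ`. -/
def SeparatedBy (γ : ℝ) (x : ℤ → ℝ) : Prop :=
  ∀ i j : ℤ, i ≠ j → γ ≤ |x i - x j|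

/-- The eigenvalues of the boundary value problem
`(-1)^r u^(2r) = λ u` on `[0,1]`, `u^(l)(0) = u^(l)(1) = 0` for `l < r`, `u ∈ C^{2r}[0,1]`,
where `u` is not identically zero (derivatives at the endpoints are one-sided). -/
def wirtingerEigenvalues (r : ℕ) : Set ℝ :=
  {lam | ∃ u : ℝ → ℝ, ContDiffOn ℝ ((2 * r : ℕ) : WithTop ℕ∞) u (Set.Icc 0 1) ∧
    (∃ x ∈ Set.Icc (0 : ℝ) 1, u x ≠ 0) ∧
    (∀ x ∈ Set.Icc (0 : ℝ) 1,
      (-1) ^ r * iteratedDerivWithin (2 * r) u (Set.Icc 0 1) x = lam * u x) ∧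
    ∀ l < r, iteratedDerivWithin l u (Set.Icc 0 1) 0 = 0 ∧
      iteratedDerivWithin l u (Set.Icc 0 1) 1 = 0}

/-- The Wirtinger–Sobolev constant `c_r`: the minimal eigenvalue of the boundary value problem
above (for `r ≥ 1` the spectrum is a nonempty discrete set of positive numbers, so the infimum
is attained). -/
def wirtingerConstant (r : ℕ) : ℝ := sInf (wirtingerEigenvalues r)

end

/-! The Wirtinger constant enters only through the bound `c_k ^ (1/(2k)) ≤ kπ`. Granting it, the gap
hypothesis gives `σ δ < k ν π`: the nodes, counted with multiplicity `k`, have density `kν/δ` larger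
than the critical density `σ/π` of functions of exponential type `σ`. The rest is a Beurling-type
sampling theorem with derivatives, uniform over all admissible node sequences.

The bound on `c_k` is variational. On the orthogonal complement of the polynomials of degree `< k`,
the `k`-th power of the Volterra operator is compact; its largest singular value is attained, and
the singular vector yields an eigenfunction whose eigenvalue is at most every Rayleigh quotient `∫
|φ^(k)|² / ∫ φ²`. The trial function `sin (πx) ^ k` has frequencies at most `kπ`, so its quotient is
at most `(kπ)^(2k)`. Integration by parts shows that eigenvalues are nonnegative.

The sampling theorem rests on uniqueness: by Jensen's formula and Stirling's estimate, an entire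
function of type `τ`, bounded on the real line and vanishing to order `k` on nodes with `τ δ < k ν
π`, is zero (`eq_zero_of_vanishing_on_centredNodes`). Both the normalized functions and the centred
node sequences form compact families, so uniqueness becomes a sup-norm inequality with a uniform
constant (`exists_mul_norm_le_norm_iteratedDeriv`). The strict density inequality leaves room to
multiply by a decaying window of small type; this localizes the estimate, and integration gives the
`L²` lower bound (`exists_lintegral_le_tsum_sampling`). The upper bound needs only separation and
Bernstein's inequality.

Finally, up to the sign `(-1)^l`, the coefficient of `f` against `M_y T_x g^(l)` is the `l`-th
derivative at `x` of the band-limited function with spectrum `conj ĝ(w) f̂(w + y)`. Sampling bounds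
each `j`-block by the squared norm of this spectrum, and by Plancherel these norms add up to `∫ (∑_j
|ĝ(v - y_j)|²) |f̂(v)|² dv`, which lies between `a ‖f‖²` and `b ‖f‖²`. -/

/-! ### Compact operators and the Volterra operator -/

section CompactOperators

variable {α H : Type*} [MeasurableSpace α] [NormedAddCommGroup H] [InnerProductSpace ℝ H]

/-- The operator `f ↦ (x ↦ ⟪f, e x⟫)` with square integrable kernel `e`, as a function of `e`. -/
noncomputable def kernelOperator (μ : Measure α) : Lp H 2 μ →L[ℝ] H →L[ℝ] Lp ℝ 2 μ :=
  (ContinuousLinearMap.compLpL₂ 2 μ (innerSL ℝ)).flip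

theorem kernelOperator_coeFn {μ : Measure α} (e : Lp H 2 μ) (f : H) :
    kernelOperator μ e f =ᵐ[μ] fun x => inner ℝ f (e x) := by
  filter_upwards [(innerSL ℝ f).coeFn_compLp e] with x hx
  exact hx

/-- The Hilbert–Schmidt argument: an indicator kernel gives a rank-one operator, the operator
depends linearly and continuously on the kernel, and compact operators form a closed subspace. -/
theorem isCompactOperator_kernelOperator {μ : Measure α} (e : Lp H 2 μ) :
    IsCompactOperator (kernelOperator μ e) := by
  refine Lp.induction (by norm_num) (fun e : Lp H 2 μ => IsCompactOperator (kernelOperator μ e))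
    ?_ ?_ ?_ e
  · intro c s hs hμs
    have key : kernelOperator μ (Lp.simpleFunc.indicatorConst 2 hs hμs.ne c : Lp H 2 μ) =
        (ContinuousLinearMap.toSpanSingleton ℝ (indicatorConstLp 2 hs hμs.ne (1 : ℝ))).comp
          (innerSL ℝ c) := by
      ext1 f
      apply Lp.ext
      rw [Lp.simpleFunc.coe_indicatorConst]
      filter_upwards [kernelOperator_coeFn (indicatorConstLp 2 hs hμs.ne c) f,
        indicatorConstLp_coeFn (p := 2) (hs := hs) (hμs := hμs.ne) (c := c),
        indicatorConstLp_coeFn (p := 2) (hs := hs) (hμs := hμs.ne) (c := (1 : ℝ)),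
        Lp.coeFn_smul (inner ℝ c f) (indicatorConstLp 2 hs hμs.ne (1 : ℝ))] with x h1 h2 h3 h4
      rw [h1, h2]
      simp only [ContinuousLinearMap.comp_apply, innerSL_apply_apply,
        ContinuousLinearMap.toSpanSingleton_apply]
      rw [h4, Pi.smul_apply, h3]
      by_cases hx : x ∈ s <;> simp [hx, real_inner_comm]
    show IsCompactOperator (kernelOperator μ _)
    rw [key]
    have h1 : IsCompactOperator (ContinuousLinearMap.toSpanSingleton ℝ
        (indicatorConstLp (μ := μ) 2 hs hμs.ne (1 : ℝ))) :=
      isCompactOperator_of_locallyCompactSpace_rng _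
    exact h1.comp_clm (innerSL ℝ c)
  · intro f g hf hg _ h1 h2
    have h3 : IsCompactOperator (kernelOperator μ (hf.toLp f + hg.toLp g)) := by
      rw [map_add]
      exact IsCompactOperator.add h1 h2
    exact h3
  · exact isClosed_setOfPred_isCompactOperator.preimage (kernelOperator μ).continuous

/-- The largest singular value of a nonzero compact operator is attained. -/
theorem IsCompactOperator.exists_adjoint_comp_eq_norm_sq_smul {V : Type*} [NormedAddCommGroup V]
    [InnerProductSpace ℝ V] [CompleteSpace V] [CompleteSpace H] {A : V →L[ℝ] H}
    (hA : IsCompactOperator A) (hA0 : A ≠ 0) :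
    0 < ‖A‖ ∧ ∃ v : V, v ≠ 0 ∧ ContinuousLinearMap.adjoint A (A v) = ‖A‖ ^ 2 • v := by
  obtain ⟨v0, hv0⟩ : ∃ v0, A v0 ≠ 0 := by
    by_contra! h
    exact hA0 (ContinuousLinearMap.ext h)
  have : Nontrivial V := ⟨v0, 0, fun h => hv0 (by simp [h])⟩
  set T : V →L[ℝ] V := (ContinuousLinearMap.adjoint A).comp A with hT
  have hTc : IsCompactOperator T := hA.clm_comp (ContinuousLinearMap.adjoint A)
  have hTn : ‖T‖ = ‖A‖ ^ 2 := by
    rw [hT, ContinuousLinearMap.norm_adjoint_comp_self, sq]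
  have hpos : 0 < ‖A‖ := norm_pos_iff.mpr hA0
  -- If `‖T‖` were in the resolvent set, the Rayleigh quotients of `T` would stay below `‖T‖ - ε`,
  -- forcing `‖A‖² ≤ ‖A‖² - ε`. Compactness then turns this nonzero spectral value into an
  -- eigenvalue.
  have hspec : ‖T‖ ∈ spectrum ℝ T := by
    by_contra hns
    have hres : algebraMap ℝ ℝ ‖T‖ ∈ resolventSet ℝ T := by
      simpa [spectrum] using hns
    obtain ⟨ε, hε, h⟩ := T.rayleighQuotient_le_of_norm_mem_resolventSet (𝕜 := ℝ) hres
    have hAv : ∀ v, ‖A v‖ ^ 2 ≤ (‖A‖ ^ 2 - ε) * ‖v‖ ^ 2 := by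
      intro v
      by_cases hv : v = 0
      · simp [hv]
      have h1 := h v
      rw [ContinuousLinearMap.rayleighQuotient, ContinuousLinearMap.reApplyInnerSelf_apply,
        div_le_iff₀ (by positivity), hTn] at h1
      rw [hT, ContinuousLinearMap.comp_apply, ContinuousLinearMap.adjoint_inner_left] at h1
      simpa using h1
    have hnn : 0 ≤ ‖A‖ ^ 2 - ε := by
      by_contra! hneg
      have h1 := hAv v0
      have h2 : 0 < ‖A v0‖ ^ 2 := by positivity
      nlinarith [sq_nonneg ‖v0‖]
    have h3 : ‖A‖ ≤ Real.sqrt (‖A‖ ^ 2 - ε) := by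
      refine ContinuousLinearMap.opNorm_le_bound _ (Real.sqrt_nonneg _) fun v => ?_
      rw [← Real.sqrt_sq (norm_nonneg (A v)), ← Real.sqrt_sq (norm_nonneg v), ← Real.sqrt_mul hnn]
      simpa using Real.sqrt_le_sqrt (hAv v)
    have h4 : ‖A‖ ^ 2 ≤ ‖A‖ ^ 2 - ε := by
      calc ‖A‖ ^ 2 ≤ Real.sqrt (‖A‖ ^ 2 - ε) ^ 2 := by gcongr
        _ = _ := Real.sq_sqrt hnn
    linarith
  have hne : ‖T‖ ≠ 0 := by rw [hTn]; positivity
  obtain ⟨v, hv⟩ := ((hTc.hasEigenvalue_iff_mem_spectrum hne).mpr hspec).exists_hasEigenvector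
  refine ⟨hpos, v, hv.2, ?_⟩
  have := hv.apply_eq_smul
  rw [hTn] at this
  exact this

end CompactOperators

/-! ### The Volterra operator on `L²(0, 1)` as a compact operator. -/

section Volterra

/-- Lebesgue measure on `(0, 1]`. -/
noncomputable abbrev unitMeasure : Measure ℝ := volume.restrict (Set.Ioc 0 1)

/-- The Volterra kernel sends `x` to the indicator of `(-∞, x]` in `L²(0, 1)`. Its continuity makes
it strongly measurable, and later makes every `volterra f` continuous. -/
theorem continuous_indicatorConstLp_Iic : Continuous fun x : ℝ =>
    indicatorConstLp (μ := unitMeasure) 2 (measurableSet_Iic (a := x)) (measure_ne_top _ _)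
      (1 : ℝ) := by
  refine continuous_indicatorConstLp_set (by norm_num) fun x => ?_
  have hb : ∀ y : ℝ, unitMeasure (symmDiff (Set.Iic y) (Set.Iic x)) ≤ ENNReal.ofReal |y - x| := by
    intro y
    refine (Measure.restrict_apply_le _ _).trans ?_
    rcases le_total y x with h | h
    · have : symmDiff (Set.Iic y) (Set.Iic x) = Set.Ioc y x := by
        ext z
        simp only [Set.mem_symmDiff, Set.mem_Iic, Set.mem_Ioc]
        constructor
        · rintro (⟨h1, h2⟩ | ⟨h1, h2⟩)
          · exact absurd (h1.trans h) h2
          · exact ⟨not_le.mp h2, h1⟩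
        · rintro ⟨h1, h2⟩
          exact Or.inr ⟨h2, not_le.mpr h1⟩
      rw [this, Real.volume_Ioc, abs_sub_comm, abs_of_nonneg (by linarith)]
    · have : symmDiff (Set.Iic y) (Set.Iic x) = Set.Ioc x y := by
        ext z
        simp only [Set.mem_symmDiff, Set.mem_Iic, Set.mem_Ioc]
        constructor
        · rintro (⟨h1, h2⟩ | ⟨h1, h2⟩)
          · exact ⟨not_le.mp h2, h1⟩
          · exact absurd (h1.trans h) h2
        · rintro ⟨h1, h2⟩
          exact Or.inl ⟨h2, not_le.mpr h1⟩
      rw [this, Real.volume_Ioc, abs_of_nonneg (by linarith)]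
  refine tendsto_of_tendsto_of_tendsto_of_le_of_le tendsto_const_nhds ?_ (fun _ => zero_le) hb
  have : Filter.Tendsto (fun y : ℝ => ENNReal.ofReal |y - x|) (nhds x)
      (nhds (ENNReal.ofReal |x - x|)) := by
    refine (ENNReal.continuous_ofReal.comp ?_).tendsto x
    fun_prop
  simpa using this

theorem norm_indicatorConstLp_Iic_le (x : ℝ) : ‖indicatorConstLp (μ := unitMeasure) 2
    (measurableSet_Iic (a := x)) (measure_ne_top _ _) (1 : ℝ)‖ ≤ 1 := by
  rw [norm_indicatorConstLp (by norm_num) (by norm_num)]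
  have : unitMeasure.real (Set.Iic x) ≤ 1 := by
    refine (measureReal_mono (Set.subset_univ _)).trans ?_
    simp [Measure.real]
  simp only [norm_one, one_mul]
  exact Real.rpow_le_one (by positivity) this (by positivity)

theorem memLp_indicatorConstLp_Iic : MemLp (fun x : ℝ =>
    indicatorConstLp (μ := unitMeasure) 2 (measurableSet_Iic (a := x)) (measure_ne_top _ _)
      (1 : ℝ)) 2 unitMeasure :=
  MemLp.of_bound continuous_indicatorConstLp_Iic.aestronglyMeasurable 1
    (Filter.Eventually.of_forall norm_indicatorConstLp_Iic_le)

/-- The Volterra operator `f ↦ (x ↦ ∫₀ˣ f)` on `L²(0, 1)`. -/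
noncomputable def volterra : Lp ℝ 2 unitMeasure →L[ℝ] Lp ℝ 2 unitMeasure :=
  kernelOperator unitMeasure memLp_indicatorConstLp_Iic.toLp

theorem isCompactOperator_volterra : IsCompactOperator volterra :=
  isCompactOperator_kernelOperator _

theorem volterra_coeFn (f : Lp ℝ 2 unitMeasure) :
    volterra f =ᵐ[unitMeasure] fun x => ∫ t in Set.Iic x, f t ∂unitMeasure := by
  filter_upwards [kernelOperator_coeFn memLp_indicatorConstLp_Iic.toLp f,
    memLp_indicatorConstLp_Iic.coeFn_toLp] with x h1 h2
  rw [volterra, h1, h2, real_inner_comm, L2.inner_indicatorConstLp_one]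

theorem integrable_coeFn_unitMeasure (f : Lp ℝ 2 unitMeasure) : Integrable f unitMeasure :=
  (Lp.memLp f).integrable (by norm_num)

/-- By Fubini the two inner products are the integrals of `g(x) f(t)` over `t ≤ x` and over its
complement, which together fill the square. The diagonal is null, so `Iic` may be traded for `Iio`.
-/
theorem inner_volterra_add (f g : Lp ℝ 2 unitMeasure) :
    inner ℝ (volterra f) g + inner ℝ f (volterra g) =
      (∫ t, f t ∂unitMeasure) * ∫ t, g t ∂unitMeasure := by
  have hf := integrable_coeFn_unitMeasure f
  have hg := integrable_coeFn_unitMeasure g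
  have hS : MeasurableSet {p : ℝ × ℝ | p.2 ≤ p.1} := measurableSet_le measurable_snd measurable_fst
  have hfg : Integrable (fun p : ℝ × ℝ => g p.1 * f p.2) (unitMeasure.prod unitMeasure) :=
    hg.mul_prod hf
  have h1 : inner ℝ (volterra f) g = ∫ p in {p : ℝ × ℝ | p.2 ≤ p.1}, g p.1 * f p.2
      ∂(unitMeasure.prod unitMeasure) := by
    rw [← integral_indicator hS, integral_prod _ (hfg.indicator hS), L2.inner_def]
    refine integral_congr_ae ?_
    filter_upwards [volterra_coeFn f] with x hx
    rw [hx, ← integral_indicator measurableSet_Iic]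
    simp only [RCLike.inner_apply, conj_trivial]
    rw [← integral_const_mul]
    congr 1
    ext t
    by_cases h : t ≤ x <;> simp [Set.indicator, h]
  have h2 : inner ℝ f (volterra g) = ∫ p in {p : ℝ × ℝ | p.2 ≤ p.1}ᶜ, g p.1 * f p.2
      ∂(unitMeasure.prod unitMeasure) := by
    rw [← integral_indicator hS.compl, integral_prod_symm _ (hfg.indicator hS.compl), L2.inner_def]
    refine integral_congr_ae ?_
    filter_upwards [volterra_coeFn g] with x hx
    have hIio : ∫ t in Set.Iic x, g t ∂unitMeasure = ∫ t in Set.Iio x, g t ∂unitMeasure :=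
      setIntegral_congr_set Iio_ae_eq_Iic.symm
    rw [hx, hIio, ← integral_indicator measurableSet_Iio]
    simp only [RCLike.inner_apply, conj_trivial]
    rw [← integral_mul_const]
    refine integral_congr_ae (Filter.Eventually.of_forall fun t => ?_)
    by_cases h : t < x
    · simp [Set.indicator, h]
    · simp [Set.indicator, h, not_lt.mp h]
  rw [h1, h2, integral_add_compl hS hfg, integral_prod_mul, mul_comm]

end Volterra

/-! ### Iterated primitives and the Dirichlet problem -/

section Primitives

/-- The primitive vanishing at `0`. -/
noncomputable def primitiveZero (f : ℝ → ℝ) : ℝ → ℝ := fun x => ∫ t in (0 : ℝ)..x, f t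

/-- The integral from `x` to `1`. -/
noncomputable def primitiveOne (f : ℝ → ℝ) : ℝ → ℝ := fun x => ∫ t in x..1, f t

theorem hasDerivAt_primitiveZero {f : ℝ → ℝ} (hf : Continuous f) (x : ℝ) :
    HasDerivAt (primitiveZero f) (f x) x :=
  intervalIntegral.integral_hasDerivAt_right (hf.intervalIntegrable _ _)
    (hf.stronglyMeasurableAtFilter _ _) hf.continuousAt

theorem hasDerivAt_primitiveOne {f : ℝ → ℝ} (hf : Continuous f) (x : ℝ) :
    HasDerivAt (primitiveOne f) (-f x) x :=
  intervalIntegral.integral_hasDerivAt_left (hf.intervalIntegrable _ _)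
    (hf.stronglyMeasurableAtFilter _ _) hf.continuousAt

theorem deriv_primitiveZero {f : ℝ → ℝ} (hf : Continuous f) : deriv (primitiveZero f) = f :=
  funext fun x => (hasDerivAt_primitiveZero hf x).deriv

theorem deriv_primitiveOne {f : ℝ → ℝ} (hf : Continuous f) : deriv (primitiveOne f) = -f :=
  funext fun x => (hasDerivAt_primitiveOne hf x).deriv

theorem contDiff_primitiveZero {f : ℝ → ℝ} {n : ℕ} (hf : ContDiff ℝ n f) :
    ContDiff ℝ (n + 1 : ℕ) (primitiveZero f) := by
  rw [Nat.cast_add, Nat.cast_one, contDiff_succ_iff_deriv, deriv_primitiveZero hf.continuous]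
  exact ⟨fun x => (hasDerivAt_primitiveZero hf.continuous x).differentiableAt, by simp, hf⟩

theorem contDiff_primitiveOne {f : ℝ → ℝ} {n : ℕ} (hf : ContDiff ℝ n f) :
    ContDiff ℝ (n + 1 : ℕ) (primitiveOne f) := by
  rw [Nat.cast_add, Nat.cast_one, contDiff_succ_iff_deriv, deriv_primitiveOne hf.continuous]
  exact ⟨fun x => (hasDerivAt_primitiveOne hf.continuous x).differentiableAt, by simp, hf.neg⟩

theorem continuous_primitiveZero {f : ℝ → ℝ} (hf : Continuous f) : Continuous (primitiveZero f) :=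
  (contDiff_primitiveZero (n := 0) (contDiff_zero.mpr hf)).continuous

theorem contDiff_iterate_primitiveZero {f : ℝ → ℝ} {n : ℕ} (hf : ContDiff ℝ n f) (k : ℕ) :
    ContDiff ℝ (n + k : ℕ) (primitiveZero^[k] f) := by
  induction k with
  | zero => simpa using hf
  | succ k ih =>
    rw [Function.iterate_succ_apply', ← add_assoc]
    exact contDiff_primitiveZero ih

theorem contDiff_iterate_primitiveOne {f : ℝ → ℝ} {n : ℕ} (hf : ContDiff ℝ n f) (k : ℕ) :
    ContDiff ℝ (n + k : ℕ) (primitiveOne^[k] f) := by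
  induction k with
  | zero => simpa using hf
  | succ k ih =>
    rw [Function.iterate_succ_apply', ← add_assoc]
    exact contDiff_primitiveOne ih

theorem iteratedDeriv_iterate_primitiveZero {f : ℝ → ℝ} (hf : Continuous f) (k m : ℕ) :
    iteratedDeriv k (primitiveZero^[m + k] f) = primitiveZero^[m] f := by
  induction k with
  | zero => simp
  | succ k ih =>
    rw [iteratedDeriv_succ', ← add_assoc, Function.iterate_succ_apply', deriv_primitiveZero, ih]
    exact (contDiff_iterate_primitiveZero (n := 0) (contDiff_zero.mpr hf) _).continuous

theorem iteratedDeriv_iterate_primitiveOne {f : ℝ → ℝ} (hf : Continuous f) (k : ℕ) :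
    iteratedDeriv k (primitiveOne^[k] f) = (-1 : ℝ) ^ k • f := by
  induction k with
  | zero => simp
  | succ k ih =>
    have hc := (contDiff_iterate_primitiveOne (n := 0) (contDiff_zero.mpr hf) k)
    rw [iteratedDeriv_succ', Function.iterate_succ_apply', deriv_primitiveOne hc.continuous]
    ext x
    rw [iteratedDeriv_neg, ih, pow_succ]
    simp

end Primitives

/-! ### Continuous representatives of `L²(0, 1)` classes. -/

section Represents

/-- The continuous function `f` represents the class `F` in `L²(0, 1)`. -/
def Represents (F : Lp ℝ 2 unitMeasure) (f : ℝ → ℝ) : Prop :=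
  Continuous f ∧ F =ᵐ[unitMeasure] f

theorem memLp_unitMeasure_of_continuous {f : ℝ → ℝ} (hf : Continuous f) :
    MemLp f 2 unitMeasure := by
  obtain ⟨C, hC⟩ := isCompact_Icc.exists_bound_of_continuousOn (s := Set.Icc (0 : ℝ) 1)
    hf.continuousOn
  refine MemLp.of_bound hf.aestronglyMeasurable C ?_
  filter_upwards [ae_restrict_mem measurableSet_Ioc] with x hx
  exact hC x (Set.Ioc_subset_Icc_self hx)

theorem represents_toLp {f : ℝ → ℝ} (hf : Continuous f) :
    Represents (memLp_unitMeasure_of_continuous hf).toLp f :=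
  ⟨hf, MemLp.coeFn_toLp _⟩

theorem integral_unitMeasure (f : ℝ → ℝ) : ∫ t, f t ∂unitMeasure = ∫ t in (0 : ℝ)..1, f t := by
  rw [intervalIntegral.integral_of_le zero_le_one]

theorem setIntegral_Iic_unitMeasure (f : ℝ → ℝ) {x : ℝ} (hx : x ∈ Set.Ioc (0 : ℝ) 1) :
    ∫ t in Set.Iic x, f t ∂unitMeasure = ∫ t in (0 : ℝ)..x, f t := by
  rw [intervalIntegral.integral_of_le hx.1.le, Measure.restrict_restrict measurableSet_Iic]
  congr 2
  ext t
  simp only [Set.mem_inter_iff, Set.mem_Iic, Set.mem_Ioc]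
  constructor
  · rintro ⟨h1, h2, h3⟩
    exact ⟨h2, h1⟩
  · rintro ⟨h1, h2⟩
    exact ⟨h2, h1, h2.trans hx.2⟩

namespace Represents

variable {F G : Lp ℝ 2 unitMeasure} {f g : ℝ → ℝ}

theorem eqOn (hf : Represents F f) (hg : Represents F g) : Set.EqOn f g (Set.Icc 0 1) := by
  have h : f =ᵐ[unitMeasure] g := hf.2.symm.trans hg.2
  rw [unitMeasure, restrict_Ioc_eq_restrict_Icc] at h
  exact Measure.eqOn_Icc_of_ae_eq (μ := volume) zero_ne_one h hf.1.continuousOn hg.1.continuousOn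

theorem eq_zero (hf : Represents F f) (h : ∀ x ∈ Set.Icc (0 : ℝ) 1, f x = 0) : F = 0 := by
  rw [Lp.eq_zero_iff_ae_eq_zero]
  filter_upwards [hf.2, ae_restrict_mem measurableSet_Ioc] with x h1 h2
  rw [h1, h x (Set.Ioc_subset_Icc_self h2)]
  rfl

theorem integral_eq (hf : Represents F f) : ∫ t, F t ∂unitMeasure = ∫ t in (0 : ℝ)..1, f t := by
  rw [integral_congr_ae hf.2, integral_unitMeasure]

theorem norm_sq (hf : Represents F f) : ‖F‖ ^ 2 = ∫ t in (0 : ℝ)..1, f t ^ 2 := by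
  rw [← integral_unitMeasure, ← real_inner_self_eq_norm_sq, L2.inner_def]
  refine integral_congr_ae ?_
  filter_upwards [hf.2] with x hx
  rw [hx]
  simp [sq]

theorem add (hf : Represents F f) (hg : Represents G g) : Represents (F + G) (f + g) := by
  refine ⟨hf.1.add hg.1, ?_⟩
  filter_upwards [hf.2, hg.2, Lp.coeFn_add F G] with x h1 h2 h3
  rw [h3, Pi.add_apply, Pi.add_apply, h1, h2]

theorem sub (hf : Represents F f) (hg : Represents G g) : Represents (F - G) (f - g) := by
  refine ⟨hf.1.sub hg.1, ?_⟩
  filter_upwards [hf.2, hg.2, Lp.coeFn_sub F G] with x h1 h2 h3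
  rw [h3, Pi.sub_apply, Pi.sub_apply, h1, h2]

theorem smul (hf : Represents F f) (c : ℝ) : Represents (c • F) (c • f) := by
  refine ⟨hf.1.const_smul c, ?_⟩
  filter_upwards [hf.2, Lp.coeFn_smul c F] with x h1 h3
  rw [h3, Pi.smul_apply, Pi.smul_apply, h1]

theorem zero : Represents 0 0 := ⟨continuous_zero, Lp.coeFn_zero _ _ _⟩

theorem sum {ι : Type*} (s : Finset ι) {F : ι → Lp ℝ 2 unitMeasure} {f : ι → ℝ → ℝ}
    (h : ∀ i ∈ s, Represents (F i) (f i)) : Represents (∑ i ∈ s, F i) (∑ i ∈ s, f i) := by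
  classical
  induction s using Finset.induction_on with
  | empty => simpa using zero
  | insert a s ha ih =>
    rw [Finset.sum_insert ha, Finset.sum_insert ha]
    exact (h a (by simp)).add (ih fun i hi => h i (by simp [hi]))

theorem volterra (hf : Represents F f) : Represents (volterra F) (primitiveZero f) := by
  refine ⟨continuous_primitiveZero hf.1, ?_⟩
  filter_upwards [volterra_coeFn F, ae_restrict_mem measurableSet_Ioc] with x h1 h2
  rw [h1, setIntegral_congr_ae measurableSet_Iic (g := f), setIntegral_Iic_unitMeasure f h2]
  · rfl
  · filter_upwards [hf.2] with t ht _ using ht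

theorem iterate_volterra (hf : Represents F f) (n : ℕ) :
    Represents ((_root_.volterra ^ n) F) (primitiveZero^[n] f) := by
  induction n with
  | zero => simpa using hf
  | succ n ih =>
    rw [pow_succ', Function.iterate_succ_apply']
    exact ih.volterra

end Represents

/-- The class of the constant function `1`. -/
noncomputable def unitOne : Lp ℝ 2 unitMeasure :=
  (memLp_unitMeasure_of_continuous (f := fun _ => 1) continuous_const).toLp

theorem represents_unitOne : Represents unitOne fun _ => 1 := represents_toLp continuous_const

theorem inner_unitOne (f : Lp ℝ 2 unitMeasure) : inner ℝ unitOne f = ∫ t, f t ∂unitMeasure := by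
  rw [L2.inner_def]
  refine integral_congr_ae ?_
  filter_upwards [represents_unitOne.2] with x hx
  rw [hx]
  simp

theorem adjoint_volterra_apply (f : Lp ℝ 2 unitMeasure) :
    ContinuousLinearMap.adjoint volterra f =
      (∫ t, f t ∂unitMeasure) • unitOne - volterra f := by
  refine ext_inner_right ℝ fun g => ?_
  rw [ContinuousLinearMap.adjoint_inner_left, inner_sub_left, real_inner_smul_left, inner_unitOne]
  linarith [inner_volterra_add f g]

namespace Represents

variable {F : Lp ℝ 2 unitMeasure} {f : ℝ → ℝ}

theorem adjoint_volterra (hf : Represents F f) :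
    Represents (ContinuousLinearMap.adjoint _root_.volterra F) (primitiveOne f) := by
  rw [adjoint_volterra_apply]
  have h := (represents_unitOne.smul (∫ t, F t ∂unitMeasure)).sub hf.volterra
  convert h using 1
  ext x
  simp only [primitiveOne, primitiveZero, Pi.sub_apply, Pi.smul_apply, smul_eq_mul, mul_one,
    hf.integral_eq]
  rw [intervalIntegral.integral_interval_sub_left] <;> exact hf.1.intervalIntegrable _ _

theorem iterate_adjoint_volterra (hf : Represents F f) (n : ℕ) :
    Represents ((ContinuousLinearMap.adjoint _root_.volterra ^ n) F) (primitiveOne^[n] f) := by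
  induction n with
  | zero => simpa using hf
  | succ n ih =>
    rw [pow_succ', Function.iterate_succ_apply']
    exact ih.adjoint_volterra

end Represents

/-- The start of the regularity bootstrap: one integration makes an arbitrary square integrable
class continuous. -/
theorem exists_represents_volterra (F : Lp ℝ 2 unitMeasure) : ∃ f, Represents (volterra F) f := by
  refine ⟨fun x => ∫ t in Set.Iic x, F t ∂unitMeasure, ?_, volterra_coeFn F⟩
  have h : Continuous fun x : ℝ => inner ℝ (indicatorConstLp (μ := unitMeasure) 2
    (measurableSet_Iic (a := x)) (measure_ne_top _ _) (1 : ℝ)) F :=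
    continuous_indicatorConstLp_Iic.inner continuous_const
  simpa only [L2.inner_indicatorConstLp_one] using h

theorem adjoint_volterra_pow_inner (n : ℕ) (f g : Lp ℝ 2 unitMeasure) :
    inner ℝ ((ContinuousLinearMap.adjoint volterra ^ n) f) g = inner ℝ f ((volterra ^ n) g) := by
  induction n generalizing g with
  | zero => simp
  | succ n ih =>
    rw [pow_succ', pow_succ, mul_apply_eq_comp, mul_apply_eq_comp,
      ContinuousLinearMap.adjoint_inner_left, ih]

end Represents

/-! ### Bounds for the Wirtinger constant -/

section Eigenvalue

/-- The span of the classes of the polynomials of degree less than `k`, in the form of iterated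
integrals of `1`. -/
noncomputable def polySpan (k : ℕ) : Submodule ℝ (Lp ℝ 2 unitMeasure) :=
  Submodule.span ℝ (Set.range fun l : Fin k =>
    (ContinuousLinearMap.adjoint volterra ^ (l : ℕ)) unitOne)

instance (k : ℕ) : FiniteDimensional ℝ (polySpan k) :=
  FiniteDimensional.span_of_finite ℝ (Set.finite_range _)

/-- Orthogonality to polynomials encodes the boundary conditions at `1`: moving the adjoint across,
the `l`-th condition says that the `(l + 1)`-fold primitive of `v` vanishes there. -/
theorem mem_polySpan_orthogonal {k : ℕ} {v : Lp ℝ 2 unitMeasure} :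
    v ∈ (polySpan k)ᗮ ↔ ∀ l < k, ∫ t, (volterra ^ l) v t ∂unitMeasure = 0 := by
  rw [polySpan, Submodule.mem_orthogonal]
  simp_rw [← inner_unitOne, ← adjoint_volterra_pow_inner]
  constructor
  · intro h l hl
    exact h _ (Submodule.subset_span ⟨⟨l, hl⟩, rfl⟩)
  · intro h u hu
    induction hu using Submodule.span_induction with
    | mem x hx =>
      obtain ⟨l, rfl⟩ := hx
      exact h l l.2
    | zero => simp
    | add x y _ _ hx hy => rw [inner_add_left, hx, hy, add_zero]
    | smul a x _ hx => rw [real_inner_smul_left, hx, mul_zero]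

theorem iteratedDeriv_eq_zero_of_le {k : ℕ} (φ : ℝ → ℝ) (hφ : ContDiff ℝ ∞ φ)
    (h0 : ∀ l < k, iteratedDeriv l φ 0 = 0) {m : ℕ} (hm : m ≤ k) :
    primitiveZero^[m] (iteratedDeriv k φ) = iteratedDeriv (k - m) φ := by
  induction m with
  | zero => simp
  | succ m ih =>
    rw [Function.iterate_succ_apply', ih (by omega)]
    have hk : k - m = k - (m + 1) + 1 := by omega
    ext x
    rw [primitiveZero, hk, iteratedDeriv_succ]
    rw [intervalIntegral.integral_deriv_eq_sub]
    · rw [h0 _ (by omega), sub_zero]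
    · intro y _
      exact ((contDiff_infty.mp hφ (k - (m + 1) + 1)).differentiable_iteratedDeriv _
        (by exact_mod_cast Nat.lt_succ_self _)) y
    · rw [← iteratedDeriv_succ]
      exact ((contDiff_infty.mp hφ _).continuous_iteratedDeriv _ le_rfl).intervalIntegrable _ _

theorem iteratedDerivWithin_Icc_eq {n : ℕ} {u : ℝ → ℝ} (hu : ContDiff ℝ n u) {x : ℝ}
    (hx : x ∈ Set.Icc (0 : ℝ) 1) :
    iteratedDerivWithin n u (Set.Icc 0 1) x = iteratedDeriv n u x :=
  iteratedDerivWithin_eq_iteratedDeriv (uniqueDiffOn_Icc zero_lt_one) hu.contDiffAt hx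

/-- The hypothesis is the weak Euler–Lagrange equation modulo polynomials of degree `< k`. It
expresses `v` through the continuous function `V^k v`, so `v` is `C^k` and `u = V^k v` is `C^{2k}`.
Differentiating `2k` times kills the polynomials and leaves `u^(2k) = τ⁻¹ (-1)^k u`. The conditions
at `0` come from integrating from `0`, those at `1` from orthogonality. -/
theorem exists_wirtingerEigenvalue_of_adjoint_comp {k : ℕ} (hk : 1 ≤ k) {τ : ℝ} (hτ : 0 < τ)
    {v : Lp ℝ 2 unitMeasure} (hv : v ≠ 0) (hvmem : v ∈ (polySpan k)ᗮ)
    (hT : (ContinuousLinearMap.adjoint volterra ^ k) ((volterra ^ k) v) - τ • v ∈ polySpan k) :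
    τ⁻¹ ∈ wirtingerEigenvalues k := by
  obtain ⟨u₀, hu₀⟩ : ∃ u₀, Represents ((volterra ^ k) v) u₀ := by
    obtain ⟨m, rfl⟩ : ∃ m, k = m + 1 := ⟨k - 1, by omega⟩
    rw [pow_succ', mul_apply_eq_comp]
    exact exists_represents_volterra _
  obtain ⟨a, ha⟩ := (Submodule.mem_span_range_iff_exists_fun ℝ).mp hT
  set v₀ : ℝ → ℝ := τ⁻¹ • (primitiveOne^[k] u₀ -
    ∑ l : Fin k, a l • primitiveOne^[(l : ℕ)] fun _ => 1) with hv₀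
  have hvrep : Represents v v₀ := by
    have h1 := ((hu₀.iterate_adjoint_volterra k).sub (Represents.sum Finset.univ
      (fun l _ => (represents_unitOne.iterate_adjoint_volterra (l : Fin k)).smul (a l)))).smul τ⁻¹
    rw [ha, sub_sub_cancel, smul_smul, inv_mul_cancel₀ hτ.ne', one_smul] at h1
    exact h1
  set u : ℝ → ℝ := primitiveZero^[k] v₀ with hu
  have hurep : Represents ((volterra ^ k) v) u := hvrep.iterate_volterra k
  have huu₀ : Set.EqOn u u₀ (Set.Icc 0 1) := hurep.eqOn hu₀
  have hone (n : ℕ) (l : ℕ) : ContDiff ℝ (n : ℕ) (primitiveOne^[l] fun _ => (1 : ℝ)) :=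
    (contDiff_iterate_primitiveOne (n := n) contDiff_const l).of_le
      (by exact_mod_cast Nat.le_add_right _ _)
  have hcd1 : ContDiff ℝ k (primitiveOne^[k] u₀) := by
    have := contDiff_iterate_primitiveOne (n := 0) (contDiff_zero.mpr hu₀.1) k
    rwa [zero_add] at this
  have hcd2 : ContDiff ℝ k (∑ l : Fin k, a l • primitiveOne^[(l : ℕ)] fun _ => (1 : ℝ)) := by
    have h : ContDiff ℝ k
        (fun x => ∑ l : Fin k, (a l • primitiveOne^[(l : ℕ)] fun _ => (1 : ℝ)) x) :=
      ContDiff.sum fun l _ => (hone k l).const_smul (a l)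
    convert h using 1
    ext x
    simp
  have hsub : ContDiff ℝ k (primitiveOne^[k] u₀ -
      ∑ l : Fin k, a l • primitiveOne^[(l : ℕ)] fun _ => (1 : ℝ)) := hcd1.sub hcd2
  have hv₀c : ContDiff ℝ k v₀ := contDiff_const.smul hsub
  have huc : ContDiff ℝ (2 * k : ℕ) u := by
    rw [two_mul]
    exact contDiff_iterate_primitiveZero hv₀c k
  have hDk : iteratedDeriv k u = v₀ := by
    simpa using iteratedDeriv_iterate_primitiveZero hv₀c.continuous k 0
  have hpoly (l : Fin k) : iteratedDeriv k (primitiveOne^[(l : ℕ)] fun _ => (1 : ℝ)) = 0 := by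
    obtain ⟨m, hm⟩ : ∃ m, k = (m + 1) + l := ⟨k - 1 - l, by omega⟩
    have hmm : iteratedDeriv k (primitiveOne^[(l : ℕ)] fun _ => (1 : ℝ)) =
        iteratedDeriv (m + 1) (iteratedDeriv l (primitiveOne^[(l : ℕ)] fun _ => (1 : ℝ))) := by
      rw [iteratedDeriv_eq_iterate, iteratedDeriv_eq_iterate, iteratedDeriv_eq_iterate,
        ← Function.iterate_add_apply, ← hm]
    rw [hmm, iteratedDeriv_iterate_primitiveOne continuous_const]
    have : ((-1 : ℝ) ^ (l : ℕ) • fun _ : ℝ => (1 : ℝ)) = fun _ => (-1 : ℝ) ^ (l : ℕ) := by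
      ext; simp
    rw [this]
    ext x
    simp [iteratedDeriv_const]
  have hDv₀ (x : ℝ) : iteratedDeriv k v₀ x = τ⁻¹ * ((-1) ^ k * u₀ x) := by
    rw [hv₀, iteratedDeriv_const_smul hsub.contDiffAt,
      iteratedDeriv_sub hcd1.contDiffAt hcd2.contDiffAt,
      iteratedDeriv_iterate_primitiveOne hu₀.1, iteratedDeriv_sum]
    · have (l : Fin k) : iteratedDeriv k (a l • primitiveOne^[(l : ℕ)] fun _ => (1 : ℝ)) x = 0 := by
        rw [iteratedDeriv_const_smul (hone k l).contDiffAt, hpoly l]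
        simp
      simp [this]
    · intro l _
      exact ((hone k l).const_smul (a l)).contDiffAt
  have hD2k (x : ℝ) : iteratedDeriv (2 * k) u x = τ⁻¹ * ((-1) ^ k * u₀ x) := by
    rw [← hDv₀, ← hDk, two_mul, iteratedDeriv_eq_iterate, iteratedDeriv_eq_iterate,
      iteratedDeriv_eq_iterate, ← Function.iterate_add_apply]
  refine ⟨u, huc.contDiffOn, ?_, ?_, ?_⟩
  -- If `u` vanished, `hT` would put `v` in `polySpan k` as well as in its orthogonal complement.
  · by_contra! h
    have h0 : (volterra ^ k) v = 0 := hurep.eq_zero h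
    rw [h0, map_zero, zero_sub] at hT
    have h1 : v ∈ polySpan k := by
      have := (polySpan k).smul_mem (-τ⁻¹) hT
      rwa [smul_neg, neg_smul, neg_neg, smul_smul, inv_mul_cancel₀ hτ.ne', one_smul] at this
    exact hv (inner_self_eq_zero (𝕜 := ℝ).mp (hvmem v h1))
  · intro x hx
    rw [iteratedDerivWithin_Icc_eq huc hx, hD2k, huu₀ hx]
    have : ((-1 : ℝ) ^ k) * (-1) ^ k = 1 := by rw [← mul_pow]; simp
    linear_combination τ⁻¹ * u₀ x * this
  · intro l hl
    have hl' : ContDiff ℝ l u := huc.of_le (by exact_mod_cast (by omega : l ≤ 2 * k))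
    obtain ⟨m, hm⟩ : ∃ m, k = (m + 1) + l := ⟨k - 1 - l, by omega⟩
    have hDl : iteratedDeriv l u = primitiveZero^[m + 1] v₀ := by
      rw [hu, hm]
      exact iteratedDeriv_iterate_primitiveZero hv₀c.continuous l (m + 1)
    rw [iteratedDerivWithin_Icc_eq hl' (by simp), iteratedDerivWithin_Icc_eq hl' (by simp), hDl,
      Function.iterate_succ_apply']
    refine ⟨by simp [primitiveZero], ?_⟩
    have h1 := mem_polySpan_orthogonal.mp hvmem m (by omega)
    rwa [(hvrep.iterate_volterra m).integral_eq] at h1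

/-- The boundary conditions say that `w = φ^(k)` is orthogonal to the polynomials and that `V^k w =
φ`. With `A` the restriction of `V^k` to that complement, the inequality is `‖A w‖ ≤ ‖A‖ ‖w‖`, and
`‖A‖⁻²` is an eigenvalue because the norm is attained. -/
theorem exists_wirtingerEigenvalue_mul_le {k : ℕ} (hk : 1 ≤ k) {φ : ℝ → ℝ} (hφ : ContDiff ℝ ∞ φ)
    (h0 : ∀ l < k, iteratedDeriv l φ 0 = 0) (h1 : ∀ l < k, iteratedDeriv l φ 1 = 0)
    (hne : ∃ x ∈ Set.Icc (0 : ℝ) 1, φ x ≠ 0) :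
    ∃ lam ∈ wirtingerEigenvalues k,
      lam * ∫ t in (0 : ℝ)..1, φ t ^ 2 ≤ ∫ t in (0 : ℝ)..1, iteratedDeriv k φ t ^ 2 := by
  have hwc : Continuous (iteratedDeriv k φ) :=
    (contDiff_infty.mp hφ _).continuous_iteratedDeriv _ le_rfl
  have hw := represents_toLp hwc
  set w : Lp ℝ 2 unitMeasure := (memLp_unitMeasure_of_continuous hwc).toLp with hwdef
  have hVw {m : ℕ} (hm : m ≤ k) : Represents ((volterra ^ m) w) (iteratedDeriv (k - m) φ) := by
    rw [← iteratedDeriv_eq_zero_of_le φ hφ h0 hm]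
    exact hw.iterate_volterra m
  have hwmem : w ∈ (polySpan k)ᗮ := by
    rw [mem_polySpan_orthogonal]
    intro l hl
    rw [(hVw hl.le).integral_eq]
    have h2 := congrFun (iteratedDeriv_eq_zero_of_le φ hφ h0 (m := l + 1) hl) 1
    rw [Function.iterate_succ_apply', iteratedDeriv_eq_zero_of_le φ hφ h0 hl.le,
      h1 _ (by omega)] at h2
    exact h2
  have hφrep : Represents ((volterra ^ k) w) φ := by simpa using hVw le_rfl
  set A : (polySpan k)ᗮ →L[ℝ] Lp ℝ 2 unitMeasure := (volterra ^ k).comp (polySpan k)ᗮ.subtypeL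
    with hA
  have hAc : IsCompactOperator A := by
    have h2 : IsCompactOperator (volterra ^ k) := by
      obtain ⟨m, rfl⟩ : ∃ m, k = m + 1 := ⟨k - 1, by omega⟩
      rw [pow_succ]
      exact isCompactOperator_volterra.clm_comp (volterra ^ m)
    exact h2.comp_clm _
  have hAw : A ⟨w, hwmem⟩ = (volterra ^ k) w := rfl
  have hA0 : A ≠ 0 := by
    intro h
    obtain ⟨x, hx, hx0⟩ := hne
    rw [← hAw, h] at hφrep
    exact hx0 (hφrep.eqOn Represents.zero hx)
  obtain ⟨hpos, v, hv, hTv⟩ := hAc.exists_adjoint_comp_eq_norm_sq_smul hA0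
  refine ⟨(‖A‖ ^ 2)⁻¹, exists_wirtingerEigenvalue_of_adjoint_comp hk (by positivity)
    (v := v) (by simpa using hv) v.2 ?_, ?_⟩
  -- The singular vector equation holds only when tested on the complement; since `polySpan k` is
  -- finite-dimensional, its double complement is itself, so the defect is a polynomial.
  · have horth (y) (hy : ∀ z ∈ (polySpan k)ᗮ, inner ℝ z y = 0) : y ∈ polySpan k := by
      rw [← (polySpan k).orthogonal_orthogonal]
      exact hy
    refine horth _ fun z hz => ?_
    have h3 : inner ℝ (⟨z, hz⟩ : (polySpan k)ᗮ) (ContinuousLinearMap.adjoint A (A v)) =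
        inner ℝ (⟨z, hz⟩ : (polySpan k)ᗮ) (‖A‖ ^ 2 • v) := by rw [hTv]
    rw [ContinuousLinearMap.adjoint_inner_right] at h3
    rw [inner_sub_right, real_inner_comm, adjoint_volterra_pow_inner, real_inner_comm, sub_eq_zero]
    exact h3
  · have h2 : ‖(volterra ^ k) w‖ ^ 2 ≤ ‖A‖ ^ 2 * ‖w‖ ^ 2 := by
      rw [← hAw, ← mul_pow]
      gcongr
      exact A.le_opNorm ⟨w, hwmem⟩
    rw [hφrep.norm_sq, hw.norm_sq] at h2
    rwa [inv_mul_le_iff₀ (by positivity)]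

end Eigenvalue

/-! ### The trial function `sin (πx) ^ k` and nonnegativity of the spectrum. -/

section WirtingerBounds

theorem iteratedDeriv_pow_eq_zero {f : ℝ → ℝ} {x : ℝ} (hf : AnalyticAt ℝ f x) (hx : f x = 0)
    {k l : ℕ} (hl : l < k) : iteratedDeriv l (f ^ k) x = 0 := by
  refine (natCast_le_analyticOrderAt_iff_iteratedDeriv_eq_zero (hf.pow k)).mp ?_ l hl
  rw [analyticOrderAt_pow hf]
  have h1 : 1 ≤ analyticOrderAt f x := by
    rw [Order.one_le_iff_ne_zero, hf.analyticOrderAt_ne_zero]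
    exact hx
  calc (k : ℕ∞) = k • 1 := by simp
    _ ≤ k • analyticOrderAt f x := by gcongr

theorem iteratedDeriv_ofReal_comp {φ : ℝ → ℝ} (hφ : ContDiff ℝ ∞ φ) (l : ℕ) :
    iteratedDeriv l (fun x => (φ x : ℂ)) = fun x => ((iteratedDeriv l φ x : ℝ) : ℂ) := by
  induction l with
  | zero => simp
  | succ l ih =>
    ext x
    rw [iteratedDeriv_succ, ih, iteratedDeriv_succ]
    refine (HasDerivAt.ofReal_comp (DifferentiableAt.hasDerivAt ?_)).deriv
    exact (contDiff_infty.mp hφ (l + 1)).differentiable_iteratedDeriv _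
      (by exact_mod_cast Nat.lt_succ_self _) x

/-- The trigonometric polynomial with frequencies `π (k - 2 m)`, `m < n`. -/
noncomputable def trigPoly (k n : ℕ) (c : ℕ → ℂ) (x : ℝ) : ℂ :=
  ∑ m ∈ Finset.range n, c m * Complex.exp (Real.pi * (k - 2 * m) * Complex.I * x)

theorem hasDerivAt_trigPoly (k n : ℕ) (c : ℕ → ℂ) (x : ℝ) : HasDerivAt (trigPoly k n c)
    (trigPoly k n (fun m => c m * (Real.pi * (k - 2 * m) * Complex.I)) x) x := by
  unfold trigPoly
  refine HasDerivAt.fun_sum fun m _ => ?_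
  have h1 : HasDerivAt (fun x : ℝ => Real.pi * (k - 2 * m) * Complex.I * (x : ℂ))
      (Real.pi * (k - 2 * m) * Complex.I * 1) x :=
    (Complex.ofRealCLM.hasDerivAt (x := x)).const_mul _
  rw [mul_one] at h1
  rw [mul_assoc (c m), mul_comm (_ * Complex.I)]
  exact h1.cexp.const_mul (c m)

theorem iteratedDeriv_trigPoly (k n : ℕ) (c : ℕ → ℂ) (l : ℕ) : iteratedDeriv l (trigPoly k n c) =
    trigPoly k n (fun m => c m * (Real.pi * (k - 2 * m) * Complex.I) ^ l) := by
  induction l with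
  | zero => simp
  | succ l ih =>
    ext x
    rw [iteratedDeriv_succ, ih, (hasDerivAt_trigPoly k n _ x).deriv]
    congr 1
    ext m
    ring

theorem integral_exp_two_pi (n : ℤ) :
    ∫ x in (0 : ℝ)..1, Complex.exp (2 * Real.pi * Complex.I * n * x) = if n = 0 then 1 else 0 := by
  split_ifs with h
  · simp [h]
  · have hne : 2 * Real.pi * Complex.I * (n : ℂ) ≠ 0 := by
      have := Real.pi_ne_zero
      simp [h, this]
    rw [integral_exp_mul_complex hne]
    have : Complex.exp (2 * Real.pi * Complex.I * n * (1 : ℝ)) = 1 := by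
      rw [← Complex.exp_int_mul_two_pi_mul_I n]
      congr 1
      push_cast
      ring
    rw [this]
    simp

/-- Parseval on `[0, 1]`: for odd `k` the exponentials are not 1-periodic, but their frequencies
differ by multiples of `2π`, so they are still orthonormal. -/
theorem integral_norm_trigPoly_sq (k n : ℕ) (c : ℕ → ℂ) :
    ∫ x in (0 : ℝ)..1, ‖trigPoly k n c x‖ ^ 2 = ∑ m ∈ Finset.range n, ‖c m‖ ^ 2 := by
  apply Complex.ofReal_injective
  rw [← intervalIntegral.integral_ofReal]
  have h1 (x : ℝ) : ((‖trigPoly k n c x‖ ^ 2 : ℝ) : ℂ) =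
      ∑ m ∈ Finset.range n, ∑ p ∈ Finset.range n, c m * starRingEnd ℂ (c p) *
        Complex.exp (2 * Real.pi * Complex.I * ((p - m : ℤ) : ℂ) * x) := by
    push_cast
    rw [← Complex.mul_conj', trigPoly, map_sum, Finset.sum_mul_sum]
    refine Finset.sum_congr rfl fun m _ => Finset.sum_congr rfl fun p _ => ?_
    rw [map_mul, ← Complex.exp_conj, mul_mul_mul_comm, ← Complex.exp_add]
    congr 2
    have h2 : starRingEnd ℂ 2 = 2 := Complex.conj_ofNat 2
    simp [h2]
    ring
  simp_rw [h1]
  have hcont (m p : ℕ) : Continuous fun x : ℝ => c m * starRingEnd ℂ (c p) *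
      Complex.exp (2 * Real.pi * Complex.I * ((p - m : ℤ) : ℂ) * x) := by fun_prop
  rw [intervalIntegral.integral_finsetSum fun m _ =>
    (continuous_finsetSum _ fun p _ => hcont m p).intervalIntegrable _ _]
  rw [Complex.ofReal_sum]
  refine Finset.sum_congr rfl fun m hm => ?_
  rw [Complex.ofReal_pow,
    intervalIntegral.integral_finsetSum fun p _ => (hcont m p).intervalIntegrable _ _]
  simp_rw [intervalIntegral.integral_const_mul, integral_exp_two_pi]
  rw [Finset.sum_eq_single m]
  · simp [Complex.mul_conj']
  · intro p _ hpm
    have : (p : ℤ) - m ≠ 0 := by omega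
    simp [this]
  · intro h
    exact absurd hm h

theorem sin_pow_eq_trigPoly (k : ℕ) (x : ℝ) : ((Real.sin (Real.pi * x) ^ k : ℝ) : ℂ) =
    trigPoly k (k + 1)
      (fun m => (Complex.I / 2) ^ k * ((-1) ^ (k - m) * (k.choose m : ℂ))) x := by
  have h1 : ((Real.sin (Real.pi * x) ^ k : ℝ) : ℂ) =
      (Complex.I / 2) ^ k * (Complex.exp (-(Real.pi * x) * Complex.I) +
        -Complex.exp ((Real.pi * x) * Complex.I)) ^ k := by
    push_cast
    rw [Complex.sin, ← mul_pow]
    congr 1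
    ring
  rw [h1, add_pow, Finset.mul_sum, trigPoly]
  refine Finset.sum_congr rfl fun m hm => ?_
  have hmk : m ≤ k := by simpa [Nat.lt_succ_iff] using hm
  rw [neg_pow (Complex.exp _), ← Complex.exp_nat_mul, ← Complex.exp_nat_mul]
  have h2 : Complex.exp (Real.pi * (k - 2 * m) * Complex.I * x) =
      Complex.exp (m * (-(Real.pi * x) * Complex.I)) *
        Complex.exp ((k - m : ℕ) * (Real.pi * x * Complex.I)) := by
    rw [← Complex.exp_add, Nat.cast_sub hmk]
    congr 1
    ring
  rw [h2]
  ring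

/-- The function `sin (πx) ^ k` vanishes to order `k` at both endpoints, and its frequencies `π (k -
2m)` are at most `kπ` in modulus, so Parseval bounds its Rayleigh quotient by `(kπ)^(2k)`. -/
theorem exists_wirtingerEigenvalue_le {k : ℕ} (hk : 1 ≤ k) :
    ∃ lam ∈ wirtingerEigenvalues k, lam ≤ (k * Real.pi) ^ (2 * k) := by
  set s : ℝ → ℝ := fun x => Real.sin (Real.pi * x) with hs
  have hsa (x : ℝ) : AnalyticAt ℝ s x := by
    have : ContDiff ℝ ω s := by
      rw [hs]
      exact Real.contDiff_sin.comp (contDiff_const.mul contDiff_id)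
    exact this.contDiffAt.analyticAt
  have hφ : ContDiff ℝ ∞ (s ^ k) := by
    have : ContDiff ℝ ∞ s := by
      rw [hs]
      exact Real.contDiff_sin.comp (contDiff_const.mul contDiff_id)
    exact this.pow k
  obtain ⟨lam, hlam, hle⟩ := exists_wirtingerEigenvalue_mul_le hk hφ
    (fun l hl => iteratedDeriv_pow_eq_zero (hsa 0) (by simp [hs]) hl)
    (fun l hl => iteratedDeriv_pow_eq_zero (hsa 1) (by simp [hs]) hl)
    ⟨1 / 2, by norm_num, by
      have : Real.pi * (1 / 2) = Real.pi / 2 := by ring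
      simp only [Pi.pow_apply, hs, this]
      simp⟩
  refine ⟨lam, hlam, ?_⟩
  set c : ℕ → ℂ := fun m => (Complex.I / 2) ^ k * ((-1) ^ (k - m) * (k.choose m : ℂ)) with hc
  have hrep : (fun x => (((s ^ k) x : ℝ) : ℂ)) = trigPoly k (k + 1) c :=
    funext fun x => sin_pow_eq_trigPoly k x
  have h1 : ∫ t in (0 : ℝ)..1, (s ^ k) t ^ 2 = ∑ m ∈ Finset.range (k + 1), ‖c m‖ ^ 2 := by
    rw [← integral_norm_trigPoly_sq k, ← hrep]
    simp only [Complex.norm_real, Real.norm_eq_abs, sq_abs]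
  have h2 : ∫ t in (0 : ℝ)..1, iteratedDeriv k (s ^ k) t ^ 2 =
      ∑ m ∈ Finset.range (k + 1), ‖c m * (Real.pi * (k - 2 * m) * Complex.I) ^ k‖ ^ 2 := by
    rw [← integral_norm_trigPoly_sq k, ← iteratedDeriv_trigPoly, ← hrep,
      iteratedDeriv_ofReal_comp hφ]
    simp only [Complex.norm_real, Real.norm_eq_abs, sq_abs]
  rw [h1, h2] at hle
  have h3 : ∑ m ∈ Finset.range (k + 1), ‖c m * (Real.pi * (k - 2 * m) * Complex.I) ^ k‖ ^ 2 ≤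
      (k * Real.pi) ^ (2 * k) * ∑ m ∈ Finset.range (k + 1), ‖c m‖ ^ 2 := by
    rw [Finset.mul_sum]
    refine Finset.sum_le_sum fun m hm => ?_
    have hmk : (m : ℝ) ≤ k := by exact_mod_cast Nat.lt_succ_iff.mp (Finset.mem_range.mp hm)
    have h4 : ‖(Real.pi * (k - 2 * m) * Complex.I : ℂ)‖ ≤ k * Real.pi := by
      have : (Real.pi * (k - 2 * m) * Complex.I : ℂ) =
          ((Real.pi * (k - 2 * m) : ℝ) : ℂ) * Complex.I := by push_cast; ring
      rw [this, norm_mul, Complex.norm_I, mul_one, Complex.norm_real, Real.norm_eq_abs, abs_mul,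
        abs_of_pos Real.pi_pos, mul_comm]
      gcongr
      rw [abs_le]
      constructor <;> linarith [Nat.cast_nonneg (α := ℝ) m]
    rw [norm_mul, norm_pow, mul_pow, ← pow_mul, mul_comm, mul_comm k 2]
    gcongr
  have h5 : 0 < ∑ m ∈ Finset.range (k + 1), ‖c m‖ ^ 2 := by
    refine Finset.sum_pos (fun m hm => ?_) (by simp)
    have : c m ≠ 0 := by
      have hch := Nat.choose_pos (Nat.lt_succ_iff.mp (Finset.mem_range.mp hm))
      simp [hc, Complex.I_ne_zero, hch.ne']
    positivity
  exact le_of_mul_le_mul_right (hle.trans h3) h5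

theorem integral_mul_iteratedDerivWithin {k : ℕ} {u : ℝ → ℝ}
    (hu : ContDiffOn ℝ ((2 * k : ℕ) : WithTop ℕ∞) u (Set.Icc 0 1))
    (hbc : ∀ l < k, iteratedDerivWithin l u (Set.Icc 0 1) 0 = 0 ∧
      iteratedDerivWithin l u (Set.Icc 0 1) 1 = 0) {j : ℕ} (hj : j ≤ k) :
    ∫ x in (0 : ℝ)..1, u x * iteratedDerivWithin (2 * k) u (Set.Icc 0 1) x =
      (-1) ^ j * ∫ x in (0 : ℝ)..1, iteratedDerivWithin j u (Set.Icc 0 1) x *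
        iteratedDerivWithin (2 * k - j) u (Set.Icc 0 1) x := by
  have hud := uniqueDiffOn_Icc (zero_lt_one (α := ℝ))
  have hcont {l : ℕ} (hl : l ≤ 2 * k) :
      ContinuousOn (iteratedDerivWithin l u (Set.Icc 0 1)) (Set.uIcc 0 1) := by
    rw [Set.uIcc_of_le zero_le_one]
    exact hu.continuousOn_iteratedDerivWithin (by exact_mod_cast hl) hud
  have hder {l : ℕ} (hl : l < 2 * k) (x : ℝ) (hx : x ∈ Set.Ioo (min (0 : ℝ) 1) (max 0 1)) :
      HasDerivAt (iteratedDerivWithin l u (Set.Icc 0 1))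
        (iteratedDerivWithin (l + 1) u (Set.Icc 0 1) x) x := by
    simp only [zero_le_one, min_eq_left, max_eq_right] at hx
    have h1 := hu.differentiableOn_iteratedDerivWithin (m := l) (by exact_mod_cast hl) hud x
      (Set.Ioo_subset_Icc_self hx)
    rw [iteratedDerivWithin_succ]
    exact h1.hasDerivWithinAt.hasDerivAt (Icc_mem_nhds hx.1 hx.2)
  induction j with
  | zero => simp
  | succ j ih =>
    rw [ih (by omega)]
    have hidx : 2 * k - j = 2 * k - (j + 1) + 1 := by omega
    rw [hidx, intervalIntegral.integral_mul_deriv_eq_deriv_mul_of_hasDerivAt (hcont (by omega))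
      (hcont (by omega)) (hder (by omega)) (hder (by omega))
      (hcont (by omega)).intervalIntegrable (hcont (by omega)).intervalIntegrable,
      (hbc j (by omega)).1, (hbc j (by omega)).2]
    ring

/-- Integrating by parts `k` times gives `lam ∫ u² = ∫ (u^(k))²`. This also supplies the lower bound
without which `sInf` would carry no information. -/
theorem wirtingerEigenvalues_nonneg {k : ℕ} {lam : ℝ} (h : lam ∈ wirtingerEigenvalues k) :
    0 ≤ lam := by
  obtain ⟨u, hu, ⟨x₀, hx₀, hux₀⟩, heq, hbc⟩ := h
  have h1 := integral_mul_iteratedDerivWithin hu hbc le_rfl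
  have h2 : ∫ x in (0 : ℝ)..1, u x * iteratedDerivWithin (2 * k) u (Set.Icc 0 1) x =
      (-1) ^ k * (lam * ∫ x in (0 : ℝ)..1, u x ^ 2) := by
    rw [← intervalIntegral.integral_const_mul, ← intervalIntegral.integral_const_mul]
    refine intervalIntegral.integral_congr fun x hx => ?_
    rw [Set.uIcc_of_le zero_le_one] at hx
    have h3 := heq x hx
    have h4 : ((-1 : ℝ) ^ k) * (-1) ^ k = 1 := by rw [← mul_pow]; simp
    linear_combination (-1) ^ k * u x * h3 -
      u x * iteratedDerivWithin (2 * k) u (Set.Icc 0 1) x * h4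
  rw [h2, mul_right_inj' (by positivity)] at h1
  have h5 : 0 ≤ lam * ∫ x in (0 : ℝ)..1, u x ^ 2 := by
    rw [h1]
    refine intervalIntegral.integral_nonneg zero_le_one fun x _ => ?_
    rw [show 2 * k - k = k by omega]
    exact mul_self_nonneg _
  refine nonneg_of_mul_nonneg_left h5 ?_
  refine intervalIntegral.integral_pos zero_lt_one (hu.continuousOn.pow 2)
    (fun x _ => sq_nonneg _) ⟨x₀, hx₀, by positivity⟩

theorem wirtingerConstant_rpow_le {k : ℕ} (hk : 1 ≤ k) :
    wirtingerConstant k ^ (1 / (2 * (k : ℝ))) ≤ k * Real.pi := by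
  obtain ⟨lam, hlam, hle⟩ := exists_wirtingerEigenvalue_le hk
  have hbdd : BddBelow (wirtingerEigenvalues k) := ⟨0, fun _ => wirtingerEigenvalues_nonneg⟩
  have h0 : 0 ≤ wirtingerConstant k := Real.sInf_nonneg fun _ => wirtingerEigenvalues_nonneg
  have h1 : wirtingerConstant k ≤ (k * Real.pi) ^ (2 * k) := (csInf_le hbdd hlam).trans hle
  have hkpi : 0 ≤ k * Real.pi := by positivity
  calc wirtingerConstant k ^ (1 / (2 * (k : ℝ)))
      ≤ ((k * Real.pi) ^ (2 * k)) ^ (1 / (2 * (k : ℝ))) := by gcongr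
    _ = k * Real.pi := by
      rw [← Real.rpow_natCast, ← Real.rpow_mul hkpi]
      have : ((2 * k : ℕ) : ℝ) * (1 / (2 * (k : ℝ))) = 1 := by
        have : (k : ℝ) ≠ 0 := by positivity
        push_cast
        field_simp
      rw [this, Real.rpow_one]

end WirtingerBounds

/-! ### Normal families and zeros of entire functions of exponential type -/

section EntireFunctions

open Filter Topology

/-- Montel's theorem through Taylor coefficients: Cauchy's estimates confine them to a compact
product, a subsequence converges coefficientwise, and dominated convergence of the series gives
local uniform convergence. -/
theorem exists_tendstoLocallyUniformly_subseq {F : ℕ → ℂ → ℂ} {B : ℝ → ℝ}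
    (hd : ∀ n, Differentiable ℂ (F n)) (hb : ∀ n R z, ‖z‖ ≤ R → ‖F n z‖ ≤ B R) :
    ∃ (φ : ℕ → ℕ) (G : ℂ → ℂ), StrictMono φ ∧
      TendstoLocallyUniformly (fun n => F (φ n)) G atTop := by
  set a : ℕ → ℕ → ℂ := fun n m => (m.factorial : ℂ)⁻¹ * iteratedDeriv m (F n) 0 with ha
  have hab (n m : ℕ) {R : ℝ} (hR : 0 < R) : ‖a n m‖ ≤ B R / R ^ m := by
    have h1 := Complex.norm_iteratedDeriv_le_of_forall_mem_sphere_norm_le (c := 0) m hR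
      (hd n).diffContOnCl (C := B R) (fun z hz => hb n R z (by simpa using hz.le))
    have hf : (0 : ℝ) < m.factorial := by exact_mod_cast m.factorial_pos
    rw [ha]
    simp only [norm_mul, norm_inv, RCLike.norm_natCast]
    rw [inv_mul_le_iff₀ hf]
    exact h1.trans_eq (mul_div_assoc _ _ _)
  have hFa (n : ℕ) (z : ℂ) : HasSum (fun m => a n m * z ^ m) (F n z) := by
    have h1 := Complex.hasSum_taylorSeries_of_entire (hd n) 0 z
    refine h1.congr_fun ?_
    intro m
    simp only [ha, sub_zero, smul_eq_mul]
    ring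
  have hcpt : IsCompact (Set.pi Set.univ fun m : ℕ => Metric.closedBall (0 : ℂ) (B 1 / 1 ^ m)) :=
    isCompact_univ_pi fun m => isCompact_closedBall _ _
  obtain ⟨α, -, φ, hφ, hlim⟩ := hcpt.tendsto_subseq (x := a) fun n m _ => by
    simpa using hab n m one_pos
  rw [tendsto_pi_nhds] at hlim
  have hαb (m : ℕ) {R : ℝ} (hR : 0 < R) : ‖α m‖ ≤ B R / R ^ m :=
    le_of_tendsto (hlim m).norm (Eventually.of_forall fun n => hab _ m hR)
  -- Cauchy's estimate at radius `2ρ`, used at radius `ρ`, gains the summable factor `(1/2)^m`.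
  have hbound {ρ : ℝ} (hρ : 0 < ρ) {c : ℂ} {m : ℕ} (hc : ‖c‖ ≤ B (2 * ρ) / (2 * ρ) ^ m) :
      ‖c‖ * ρ ^ m ≤ B (2 * ρ) * (1 / 2) ^ m := by
    calc ‖c‖ * ρ ^ m ≤ B (2 * ρ) / (2 * ρ) ^ m * ρ ^ m := by gcongr
      _ = B (2 * ρ) * (1 / 2) ^ m := by
        rw [mul_pow, one_div, inv_pow]
        field_simp
  have hsum (ρ : ℝ) : Summable fun m : ℕ => B (2 * ρ) * (1 / 2 : ℝ) ^ m :=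
    summable_geometric_two.mul_left _
  refine ⟨φ, fun z => ∑' m, α m * z ^ m, hφ, ?_⟩
  rw [tendstoLocallyUniformly_iff_forall_isCompact]
  intro K hK
  obtain ⟨ρ, hρ, hKρ⟩ : ∃ ρ : ℝ, 0 < ρ ∧ ∀ z ∈ K, ‖z‖ ≤ ρ := by
    obtain ⟨C, hC⟩ := hK.isBounded.exists_norm_le
    exact ⟨max C 1, by positivity, fun z hz => (hC z hz).trans (le_max_left _ _)⟩
  have hdiff (n m : ℕ) : ‖α m - a (φ n) m‖ * ρ ^ m ≤ 2 * (B (2 * ρ) * (1 / 2) ^ m) := by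
    calc ‖α m - a (φ n) m‖ * ρ ^ m ≤ (‖α m‖ + ‖a (φ n) m‖) * ρ ^ m := by
          gcongr
          exact norm_sub_le _ _
      _ = ‖α m‖ * ρ ^ m + ‖a (φ n) m‖ * ρ ^ m := add_mul _ _ _
      _ ≤ _ := by
        rw [two_mul]
        exact add_le_add (hbound hρ (hαb m (by positivity))) (hbound hρ (hab _ m (by positivity)))
  have hsum2 (n : ℕ) : Summable fun m : ℕ => ‖α m - a (φ n) m‖ * ρ ^ m :=
    Summable.of_nonneg_of_le (fun m => by positivity) (hdiff n) ((hsum ρ).mul_left 2)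
  have hS : Tendsto (fun n => ∑' m, ‖α m - a (φ n) m‖ * ρ ^ m) atTop (𝓝 0) := by
    have h1 := tendsto_tsum_of_dominated_convergence (β := ℕ)
      (f := fun n m => ‖α m - a (φ n) m‖ * ρ ^ m) (g := fun _ => (0 : ℝ))
      ((hsum ρ).mul_left 2) (?_ : ∀ m, Tendsto _ atTop _) ?_
    · simpa using h1
    · intro m
      have h2 := ((tendsto_const_nhds (x := α m)).sub (hlim m)).norm.mul_const (ρ ^ m)
      simpa using h2
    · refine Eventually.of_forall fun n m => ?_
      rw [Real.norm_of_nonneg (by positivity)]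
      exact hdiff n m
  rw [Metric.tendstoUniformlyOn_iff]
  intro ε hε
  filter_upwards [hS.eventually (gt_mem_nhds hε)] with n hn z hz
  refine lt_of_le_of_lt ?_ hn
  have hz' : ‖z‖ ≤ ρ := hKρ z hz
  have hαs : Summable fun m => α m * z ^ m := by
    refine Summable.of_norm_bounded (hsum ρ) fun m => ?_
    rw [norm_mul, norm_pow]
    refine le_trans ?_ (hbound hρ (hαb m (by positivity)))
    gcongr
  rw [dist_eq_norm, ← (hFa (φ n) z).tsum_eq, ← hαs.tsum_sub (hFa (φ n) z).summable]
  have hterm (m : ℕ) : ‖α m * z ^ m - a (φ n) m * z ^ m‖ ≤ ‖α m - a (φ n) m‖ * ρ ^ m := by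
    rw [← sub_mul, norm_mul, norm_pow]
    gcongr
  exact tsum_of_norm_bounded (hsum2 n).hasSum hterm

theorem tendstoLocallyUniformly_iteratedDeriv {F : ℕ → ℂ → ℂ} {G : ℂ → ℂ}
    (hd : ∀ n, Differentiable ℂ (F n)) (h : TendstoLocallyUniformly F G atTop) (l : ℕ) :
    TendstoLocallyUniformly (fun n => iteratedDeriv l (F n)) (iteratedDeriv l G) atTop := by
  induction l with
  | zero => simpa using h
  | succ l ih =>
    simp only [iteratedDeriv_succ]
    rw [← tendstoLocallyUniformlyOn_univ] at ih ⊢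
    refine ih.deriv (Eventually.of_forall fun n => ?_) isOpen_univ
    exact ((hd n).contDiff.differentiable_iteratedDeriv (n := ⊤) l
      (by exact_mod_cast WithTop.coe_lt_top _)).differentiableOn

theorem integral_abs_sin : ∫ θ in (0 : ℝ)..(2 * Real.pi), |Real.sin θ| = 4 := by
  have hc : Continuous fun θ => |Real.sin θ| := by fun_prop
  rw [← intervalIntegral.integral_add_adjacent_intervals (b := Real.pi)
    (hc.intervalIntegrable _ _) (hc.intervalIntegrable _ _)]
  have h1 : ∫ θ in (0 : ℝ)..Real.pi, |Real.sin θ| = ∫ θ in (0 : ℝ)..Real.pi, Real.sin θ := by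
    refine intervalIntegral.integral_congr fun θ hθ => ?_
    rw [Set.uIcc_of_le Real.pi_pos.le] at hθ
    exact abs_of_nonneg (Real.sin_nonneg_of_mem_Icc hθ)
  have h2 : ∫ θ in Real.pi..(2 * Real.pi), |Real.sin θ| =
      ∫ θ in Real.pi..(2 * Real.pi), -Real.sin θ := by
    refine intervalIntegral.integral_congr fun θ hθ => ?_
    rw [Set.uIcc_of_le (by linarith [Real.pi_pos])] at hθ
    refine abs_of_nonpos ?_
    have := Real.sin_nonneg_of_mem_Icc (x := θ - Real.pi) ⟨by linarith [hθ.1], by linarith [hθ.2]⟩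
    rw [Real.sin_sub_pi] at this
    linarith
  rw [h1, h2, intervalIntegral.integral_neg, integral_sin, integral_sin]
  simp
  norm_num

theorem circleAverage_abs_im (τ : ℝ) {R : ℝ} (hR : 0 ≤ R) :
    Real.circleAverage (fun z => τ * |z.im|) 0 R = 2 * τ * R / Real.pi := by
  have h1 (θ : ℝ) : τ * |(circleMap 0 R θ).im| = τ * R * |Real.sin θ| := by
    have h2 : (circleMap 0 R θ).im = R * Real.sin θ := by
      rw [circleMap_zero, Complex.im_ofReal_mul, Complex.exp_ofReal_mul_I_im]
    rw [h2, abs_mul, abs_of_nonneg hR, mul_assoc]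
  rw [Real.circleAverage]
  simp_rw [h1]
  rw [intervalIntegral.integral_const_mul, integral_abs_sin]
  simp only [smul_eq_mul]
  field_simp
  ring

/-- Jensen's formula: the circle mean of `log ‖F‖` is at most that of `τ |Im z|`, namely `2τR/π`,
while each listed point contributes at least `k log (R/|x|)` and the other zeros contribute
nonnegatively. -/
theorem sum_log_le_of_zeros {F : ℂ → ℂ} (hd : Differentiable ℂ F) {τ : ℝ} (hτ : 0 ≤ τ)
    (hb : ∀ z, ‖F z‖ ≤ Real.exp (τ * |z.im|)) (hF0 : F 0 ≠ 0) {R : ℝ} (hR : 0 < R) {k : ℕ}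
    {S : Finset ℝ} (hS : ∀ x ∈ S, |x| ≤ R)
    (hz : ∀ x ∈ S, ∀ l < k, iteratedDeriv l F (x : ℂ) = 0) :
    ∑ x ∈ S, k * Real.log (R / |x|) + Real.log ‖F 0‖ ≤ 2 * τ * R / Real.pi := by
  have hA : AnalyticOnNhd ℂ F (Metric.closedBall 0 |R|) := fun z _ => hd.analyticAt z
  have hjensen := hA.circleAverage_log_norm hR.ne' hF0
  have hle : Real.circleAverage (fun z => Real.log ‖F z‖) 0 R ≤ 2 * τ * R / Real.pi := by
    rw [← circleAverage_abs_im τ hR.le]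
    refine Real.circleAverage_mono
      (hA.mono Metric.sphere_subset_closedBall).meromorphicOn.circleIntegrable_log_norm ?_ ?_
    · exact ContinuousOn.circleIntegrable hR.le (by fun_prop)
    · intro z _
      by_cases h : F z = 0
      -- At a zero the convention `Real.log 0 = 0` applies, so the comparison needs `0 ≤ τ |Im z|`.
      · simp only [h, norm_zero, Real.log_zero]
        positivity
      · rw [← Real.log_exp (τ * |z.im|)]
        exact Real.log_le_log (norm_pos_iff.mpr h) (hb z)
  set D := MeromorphicOn.divisor F (Metric.closedBall 0 |R|) with hD
  have hDnn (u : ℂ) : 0 ≤ D u := MeromorphicOn.AnalyticOnNhd.divisor_nonneg hA u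
  have hterm (u : ℂ) : 0 ≤ (D u : ℝ) * Real.log (R * ‖0 - u‖⁻¹) := by
    by_cases hu : u ∈ Metric.closedBall (0 : ℂ) |R|
    · refine mul_nonneg (by exact_mod_cast hDnn u) ?_
      rw [zero_sub, norm_neg]
      by_cases hu0 : u = 0
      · simp [hu0]
      · refine Real.log_nonneg ?_
        rw [← div_eq_mul_inv, one_le_div (norm_pos_iff.mpr hu0)]
        simpa [abs_of_pos hR] using hu
    · rw [D.apply_eq_zero_of_notMem hu]
      simp
  have hDk (x : ℝ) (hx : x ∈ S) : (k : ℝ) ≤ D x := by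
    have hxb : (x : ℂ) ∈ Metric.closedBall (0 : ℂ) |R| := by
      simpa [abs_of_pos hR] using hS x hx
    have h1 : (k : ℕ∞) ≤ analyticOrderAt F x :=
      (natCast_le_analyticOrderAt_iff_iteratedDeriv_eq_zero (hd.analyticAt _)).mpr (hz x hx)
    -- An infinite order would force `F` to vanish identically, against `F 0 ≠ 0`; it must be
    -- excluded because `untop₀` sends `⊤` to `0`.
    have h2 : analyticOrderAt F x ≠ ⊤ := by
      rw [Ne, analyticOrderAt_eq_top]
      intro h
      have h3 : AnalyticOnNhd ℂ F Set.univ := fun z _ => hd.analyticAt z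
      have h4 := h3.eqOn_zero_of_preconnected_of_eventuallyEq_zero isPreconnected_univ
        (Set.mem_univ _) h
      exact hF0 (h4 (Set.mem_univ 0))
    rw [hD, MeromorphicOn.AnalyticOnNhd.divisor_apply hA hxb]
    obtain ⟨n, hn⟩ := ENat.ne_top_iff_exists.mp h2
    rw [← hn] at h1 ⊢
    have h5 : k ≤ n := by exact_mod_cast h1
    have h6 : (((n : ℕ∞).map (fun n : ℕ => (n : ℤ))).untop₀) = (n : ℤ) := rfl
    rw [h6]
    exact_mod_cast h5
  have hfin : (Function.support fun u => (D u : ℝ) * Real.log (R * ‖0 - u‖⁻¹)).Finite :=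
    (D.finiteSupport (isCompact_closedBall _ _)).subset fun u hu => by
      simp only [Function.mem_support] at hu ⊢
      intro h
      exact hu (by simp [h])
  have hsum : ∑ x ∈ S, k * Real.log (R / |x|) ≤ ∑ᶠ u, (D u : ℝ) * Real.log (R * ‖0 - u‖⁻¹) := by
    classical
    set T : Finset ℂ := S.map ⟨fun x : ℝ => (x : ℂ), Complex.ofReal_injective⟩ with hT
    rw [finsum_eq_sum_of_support_subset (s := hfin.toFinset ∪ T) _ (by
      intro u hu
      simp only [Finset.coe_union, Set.Finite.coe_toFinset]
      exact Or.inl hu)]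
    refine le_trans ?_ (Finset.sum_le_sum_of_subset_of_nonneg Finset.subset_union_right
      fun u _ _ => hterm u)
    rw [hT, Finset.sum_map]
    refine Finset.sum_le_sum fun x hx => ?_
    simp only [Function.Embedding.coeFn_mk, zero_sub, norm_neg, Complex.norm_real, Real.norm_eq_abs,
      ← div_eq_mul_inv]
    refine mul_le_mul_of_nonneg_right (hDk x hx) ?_
    by_cases hx0 : x = 0
    · simp [hx0]
    · refine Real.log_nonneg ?_
      rw [one_le_div (abs_pos.mpr hx0)]
      exact hS x hx
  linarith

end EntireFunctions

/-! ### Uniqueness above the critical density, and its uniform version by compactness. -/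

section Density

open Filter Topology

/-- Separated points of which at least `2 n ν` lie in `[-n δ, n δ]`, for every `n`. -/
structure CentredNodes (γ : ℝ) (ν : ℕ) (δ : ℝ) (x : ℤ → ℝ) : Prop where
  separated : SeparatedBy γ x
  abs_le : ∀ (n : ℕ) (i : ℤ), -(n * ν : ℤ) < i → i ≤ n * ν → |x i| ≤ n * δ

/-- The upper half of Stirling's estimate for `log M!`; the logarithmic error is negligible against
the linear density gap. -/
theorem sum_range_log_succ_le {M : ℕ} (hM : 1 ≤ M) :
    ∑ m ∈ Finset.range M, Real.log (m + 1) ≤ M * Real.log M - M + Real.log M + 1 := by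
  induction M, hM using Nat.le_induction with
  | base => simp
  | succ M hM ih =>
    rw [Finset.sum_range_succ]
    have hM0 : (0 : ℝ) < M := by exact_mod_cast hM
    have h1 := Real.one_sub_inv_le_log_of_pos (x := (M + 1) / M) (by positivity)
    rw [Real.log_div (by positivity) (by positivity)] at h1
    have h2 : 1 ≤ (M + 1) * (Real.log (M + 1) - Real.log M) := by
      calc (1 : ℝ) = (M + 1) * (1 - ((M + 1) / M : ℝ)⁻¹) := by field_simp; ring
        _ ≤ _ := by gcongr
    push_cast
    linarith

/-- Passing from `n` to `n + 1` adds a shell of exactly `2ν` indices, whose nodes have modulus at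
most `(n + 1) δ`. -/
theorem CentredNodes.le_sum_log {γ δ : ℝ} {ν : ℕ} {x : ℤ → ℝ} (hx : CentredNodes γ ν δ x)
    (hx0 : ∀ i, x i ≠ 0) {M : ℕ} (hM : 1 ≤ M) {n : ℕ} :
    ∑ m ∈ Finset.range n, 2 * ν * Real.log (M / (m + 1)) ≤
      ∑ i ∈ Finset.Ioc (-(n * ν : ℤ)) (n * ν), Real.log (M * δ / |x i|) := by
  have hM0 : (0 : ℝ) < M := by exact_mod_cast hM
  induction n with
  | zero => simp
  | succ n ih =>
    have hsub : Finset.Ioc (-(n * ν : ℤ)) (n * ν) ⊆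
        Finset.Ioc (-((n + 1 : ℕ) * ν : ℤ)) ((n + 1 : ℕ) * ν) := by
      have : (n * ν : ℤ) ≤ (n + 1 : ℕ) * ν := by push_cast; nlinarith
      exact Finset.Ioc_subset_Ioc (by linarith) this
    rw [Finset.sum_range_succ, ← Finset.sum_sdiff hsub, add_comm]
    refine add_le_add ?_ ih
    have hcard : ((Finset.Ioc (-((n + 1 : ℕ) * ν : ℤ)) ((n + 1 : ℕ) * ν) \
        Finset.Ioc (-(n * ν : ℤ)) (n * ν)).card : ℝ) = 2 * ν := by
      have h1 : ((n + 1 : ℕ) * ν - -((n + 1 : ℕ) * ν : ℤ) : ℤ) = ((2 * ((n + 1) * ν) : ℕ) : ℤ) := by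
        push_cast; ring
      have h2 : (n * ν - -(n * ν : ℤ) : ℤ) = ((2 * (n * ν) : ℕ) : ℤ) := by push_cast; ring
      rw [Finset.card_sdiff_of_subset hsub, Int.card_Ioc, Int.card_Ioc, h1, h2, Int.toNat_natCast,
        Int.toNat_natCast]
      have h3 : 2 * ((n + 1) * ν) - 2 * (n * ν) = 2 * ν := by
        rw [add_mul, one_mul, mul_add, Nat.add_sub_cancel_left]
      rw [h3]
      push_cast
      ring
    rw [← hcard, ← nsmul_eq_mul]
    refine Finset.card_nsmul_le_sum _ _ _ fun i hi => ?_
    rw [Finset.mem_sdiff, Finset.mem_Ioc] at hi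
    have h1 := hx.abs_le (n + 1) i hi.1.1 hi.1.2
    have h2 : 0 < |x i| := abs_pos.mpr (hx0 i)
    refine Real.log_le_log (by positivity) ?_
    push_cast at h1
    rw [div_le_div_iff₀ (by positivity) h2]
    calc M * |x i| ≤ M * ((n + 1) * δ) := by gcongr
      _ = M * δ * (n + 1) := by ring

/-- Suppose `F 0 ≠ 0`. In Jensen's inequality at radius `Mδ` the zeros contribute at least `2kν (M -
log M - 1)`, against growth at most `2τδM/π`. The density hypothesis makes the first slope larger,
which is absurd for large `M`. -/
theorem eq_zero_of_vanishing_on_centredNodes {F : ℂ → ℂ} (hd : Differentiable ℂ F) {τ : ℝ}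
    (hτ : 0 ≤ τ) (hb : ∀ z, ‖F z‖ ≤ Real.exp (τ * |z.im|)) {γ δ : ℝ} (hγ : 0 < γ) (hδ : 0 < δ)
    {ν k : ℕ} (hk : 1 ≤ k) (hdens : τ * δ < k * ν * Real.pi) {x : ℤ → ℝ}
    (hx : CentredNodes γ ν δ x) (hz : ∀ i, ∀ l < k, iteratedDeriv l F (x i : ℂ) = 0) : F 0 = 0 := by
  by_contra hF0
  have hx0 (i : ℤ) : x i ≠ 0 := by
    intro h
    have := hz i 0 (by omega)
    rw [h] at this
    exact hF0 (by simpa using this)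
  -- Separation keeps the nodes distinct, so that each one counts `k` times in Jensen's formula.
  have hinj : Function.Injective x := by
    intro i j hij
    by_contra hne
    have := hx.separated i j hne
    rw [hij] at this
    simp at this
    linarith
  set c : ℝ := 2 * k * ν - 2 * τ * δ / Real.pi with hc
  have hcpos : 0 < c := by
    rw [hc, sub_pos, div_lt_iff₀ Real.pi_pos]
    linarith
  set q : ℝ := 2 * k * ν with hq
  have hq0 : 0 < q := by
    have : 0 ≤ 2 * τ * δ / Real.pi := by positivity
    linarith
  have key (M : ℕ) (hM : 1 ≤ M) : c * M ≤ q * (Real.log M + 1) - Real.log ‖F 0‖ := by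
    have hM0 : (0 : ℝ) < M := by exact_mod_cast hM
    have h1 := sum_log_le_of_zeros hd hτ hb hF0 (R := M * δ) (by positivity) (k := k)
      (S := (Finset.Ioc (-(M * ν : ℤ)) (M * ν)).map ⟨x, hinj⟩) (by
        intro y hy
        obtain ⟨i, hi, rfl⟩ := Finset.mem_map.mp hy
        rw [Finset.mem_Ioc] at hi
        exact hx.abs_le M i hi.1 hi.2) (by
        intro y hy
        obtain ⟨i, hi, rfl⟩ := Finset.mem_map.mp hy
        exact hz i)
    rw [Finset.sum_map, ← Finset.mul_sum] at h1
    simp only [Function.Embedding.coeFn_mk] at h1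
    have h2 := hx.le_sum_log hx0 hM (n := M)
    rw [← Finset.mul_sum] at h2
    have h3 : ∑ m ∈ Finset.range M, Real.log (M / (m + 1)) =
        M * Real.log M - ∑ m ∈ Finset.range M, Real.log ((m : ℝ) + 1) := by
      have h6 (m : ℕ) : Real.log (M / (m + 1)) = Real.log M - Real.log ((m : ℝ) + 1) :=
        Real.log_div hM0.ne' (by positivity)
      simp_rw [h6]
      rw [Finset.sum_sub_distrib]
      simp
    have h4 := sum_range_log_succ_le hM
    have h5 : q * (M - Real.log M - 1) + Real.log ‖F 0‖ ≤ 2 * τ * (M * δ) / Real.pi := by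
      refine le_trans ?_ h1
      have h6 : 2 * ν * (M - Real.log M - 1) ≤
          ∑ i ∈ Finset.Ioc (-(M * ν : ℤ)) (M * ν), Real.log (M * δ / |x i|) := by
        refine le_trans ?_ h2
        rw [h3]
        exact mul_le_mul_of_nonneg_left (by linarith) (by positivity)
      have h7 := mul_le_mul_of_nonneg_left h6 (Nat.cast_nonneg (α := ℝ) k)
      have h8 : q * (M - Real.log M - 1) = k * (2 * ν * (M - Real.log M - 1)) := by rw [hq]; ring
      linarith
    have h9 : c * M = q * M - 2 * τ * (M * δ) / Real.pi := by rw [hc]; ring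
    linarith
  -- With this `A`, the tangent bound `log M ≤ M/A + log A - 1` turns `q (log M + 1)` into `cM/2`
  -- plus a constant, absorbing half of `c M`.
  set A : ℝ := 2 * q / c with hA
  have hA0 : 0 < A := by positivity
  obtain ⟨M, hM⟩ := exists_nat_gt (max 1 ((q * (Real.log A) - Real.log ‖F 0‖) / (c / 2)))
  have hM1 : (1 : ℝ) < M := (le_max_left _ _).trans_lt hM
  have hM2 := (le_max_right _ _).trans_lt hM
  rw [div_lt_iff₀ (by positivity)] at hM2
  have h1 := key M (by exact_mod_cast hM1.le)
  have h2 := Real.log_le_sub_one_of_pos (x := M / A) (by positivity)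
  rw [Real.log_div (by positivity) hA0.ne'] at h2
  have h3 : q * (Real.log M + 1) ≤ q * (M / A + Real.log A) :=
    mul_le_mul_of_nonneg_left (by linarith) hq0.le
  have h4 : q * (M / A) = M * (c / 2) := by
    rw [hA]
    field_simp
  linarith

theorem SeparatedBy.of_tendsto {γ : ℝ} {x : ℕ → ℤ → ℝ} {y : ℤ → ℝ}
    (hx : ∀ n, SeparatedBy γ (x n)) (h : Tendsto x atTop (𝓝 y)) : SeparatedBy γ y := by
  rw [tendsto_pi_nhds] at h
  intro i j hij
  exact ge_of_tendsto ((h i).sub (h j)).abs (Eventually.of_forall fun n => hx n i j hij)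

theorem CentredNodes.of_tendsto {γ δ : ℝ} {ν : ℕ} {x : ℕ → ℤ → ℝ} {y : ℤ → ℝ}
    (hx : ∀ n, CentredNodes γ ν δ (x n)) (h : Tendsto x atTop (𝓝 y)) : CentredNodes γ ν δ y := by
  refine ⟨SeparatedBy.of_tendsto (fun n => (hx n).separated) h, fun n i h1 h2 => ?_⟩
  rw [tendsto_pi_nhds] at h
  exact le_of_tendsto (h i).abs (Eventually.of_forall fun m => (hx m).abs_le n i h1 h2)

/-- Each coordinate stays in a fixed interval, so Tychonoff applies. Taking `|i| + 1` rather than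
`|i|` accommodates the strict lower inequality on the index. -/
theorem CentredNodes.exists_tendsto_subseq {γ δ : ℝ} {ν : ℕ} (hν : 1 ≤ ν) {x : ℕ → ℤ → ℝ}
    (hx : ∀ n, CentredNodes γ ν δ (x n)) :
    ∃ (φ : ℕ → ℕ) (y : ℤ → ℝ), StrictMono φ ∧ Tendsto (x ∘ φ) atTop (𝓝 y) := by
  have hcpt : IsCompact (Set.pi Set.univ fun i : ℤ =>
      Set.Icc (-((i.natAbs + 1 : ℕ) * δ)) ((i.natAbs + 1 : ℕ) * δ)) :=
    isCompact_univ_pi fun m => isCompact_Icc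
  obtain ⟨y, -, φ, hφ, hlim⟩ := hcpt.tendsto_subseq (x := x) fun n i _ => by
    refine _root_.abs_le.mp ?_
    have hν' : (1 : ℤ) ≤ ν := by exact_mod_cast hν
    have h1 : ((i.natAbs + 1 : ℕ) : ℤ) ≤ (i.natAbs + 1 : ℕ) * ν :=
      le_mul_of_one_le_right (by positivity) hν'
    exact (hx n).abs_le (i.natAbs + 1) i (by omega) (by omega)
  exact ⟨φ, y, hφ, hlim⟩

/-- If no uniform `ε` existed, functions and nodes with samples tending to zero would have limits:
an entire function of the same type vanishing to order `k` at nodes that are still separated.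
Uniqueness makes it zero at the origin, contradicting the lower bound `1/2`. -/
theorem exists_le_norm_iteratedDeriv_of_centredNodes {τ : ℝ} (hτ : 0 ≤ τ) {γ δ : ℝ} (hγ : 0 < γ)
    (hδ : 0 < δ) {ν k : ℕ} (hν : 1 ≤ ν) (hk : 1 ≤ k) (hdens : τ * δ < k * ν * Real.pi) :
    ∃ ε : ℝ, 0 < ε ∧ ∀ (F : ℂ → ℂ) (x : ℤ → ℝ), Differentiable ℂ F →
      (∀ z, ‖F z‖ ≤ Real.exp (τ * |z.im|)) → CentredNodes γ ν δ x → 1 / 2 ≤ ‖F 0‖ →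
      ∃ i, ∃ l < k, ε ≤ ‖iteratedDeriv l F (x i : ℂ)‖ := by
  by_contra! h
  choose! F x hd hb hx hF0 hsmall using fun n : ℕ => h (1 / (n + 1 : ℝ)) (by positivity)
  obtain ⟨φ, y, hφ, hy⟩ := CentredNodes.exists_tendsto_subseq hν hx
  obtain ⟨ψ, G, hψ, hG⟩ := exists_tendstoLocallyUniformly_subseq (F := fun n => F (φ n))
    (B := fun R => Real.exp (τ * R)) (fun n => hd _) fun n R z hz => (hb _ z).trans (by
      gcongr
      exact (Complex.abs_im_le_norm z).trans hz)
  have hGd : Differentiable ℂ G := by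
    rw [← differentiableOn_univ]
    rw [← tendstoLocallyUniformlyOn_univ] at hG
    exact hG.differentiableOn (Eventually.of_forall fun n => (hd _).differentiableOn) isOpen_univ
  have hpt (z : ℂ) : Tendsto (fun n => F (φ (ψ n)) z) atTop (𝓝 (G z)) :=
    hG.tendsto_comp hGd.continuous.continuousAt tendsto_const_nhds
  have hy' : Tendsto (fun n => x (φ (ψ n))) atTop (𝓝 y) := hy.comp hψ.tendsto_atTop
  have h0 : G 0 = 0 := by
    refine eq_zero_of_vanishing_on_centredNodes hGd hτ
      (fun z => le_of_tendsto (hpt z).norm (Eventually.of_forall fun n => hb _ z)) hγ hδ hk hdens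
      (CentredNodes.of_tendsto (fun n => hx _) hy') fun i l hl => ?_
    have h1 := (tendstoLocallyUniformly_iteratedDeriv (fun n => hd _) hG l).tendsto_comp
      (g := fun n => ((x (φ (ψ n)) i : ℝ) : ℂ)) (x := (y i : ℂ))
      ((hGd.contDiff (n := l)).continuous_iteratedDeriv l le_rfl).continuousAt
      ((Complex.continuous_ofReal.tendsto _).comp ((tendsto_pi_nhds.mp hy') i))
    have h2 : Tendsto (fun n : ℕ => 1 / ((φ (ψ n) : ℕ) + 1 : ℝ)) atTop (𝓝 0) :=
      tendsto_one_div_add_atTop_nhds_zero_nat.comp (hφ.comp hψ).tendsto_atTop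
    exact tendsto_nhds_unique h1
      (squeeze_zero_norm (fun n => (hsmall _ i l hl).le) h2)
  have h3 : 1 / 2 ≤ ‖G 0‖ := ge_of_tendsto (hpt 0).norm (Eventually.of_forall fun n => hF0 _)
  rw [h0, norm_zero] at h3
  norm_num at h3

end Density

/-! ### Sampling inequalities for functions of exponential type -/

section SupSampling

open Filter Topology

/-- Phragmén–Lindelöf in each half-plane. It replaces an arbitrary growth constant by the supremum
on the real line, so that dividing by this supremum lands in one compact family. -/
theorem norm_le_mul_exp_of_bounded_on_real {F : ℂ → ℂ} (hd : Differentiable ℂ F) {τ A C : ℝ}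
    (hA : ∀ z, ‖F z‖ ≤ A * Real.exp (τ * |z.im|)) (hC : ∀ t : ℝ, ‖F t‖ ≤ C) (z : ℂ) :
    ‖F z‖ ≤ C * Real.exp (τ * |z.im|) := by
  have half {G : ℂ → ℂ} (hd : Differentiable ℂ G) (hA : ∀ z, ‖G z‖ ≤ A * Real.exp (τ * |z.im|))
      (hC : ∀ t : ℝ, ‖G t‖ ≤ C) (z : ℂ) (hz : 0 ≤ z.im) :
      ‖G z‖ ≤ C * Real.exp (τ * |z.im|) := by
    -- The rotation carries the upper half-plane to the right one, and the exponential cancels the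
    -- growth there while having modulus one on the boundary.
    set f : ℂ → ℂ := fun w => G (Complex.I * w) * Complex.exp (-(τ * w)) with hf
    have hfd : Differentiable ℂ f := by
      rw [hf]
      exact (hd.comp (differentiable_id.const_mul _)).mul (by fun_prop)
    have hexp (w : ℂ) : ‖Complex.exp (-(τ * w))‖ = Real.exp (-(τ * w.re)) := by
      rw [Complex.norm_exp]
      simp
    have hfA (w : ℂ) (hw : 0 ≤ w.re) : ‖f w‖ ≤ A := by
      have h1 := hA (Complex.I * w)
      rw [Complex.I_mul_im, abs_of_nonneg hw] at h1
      calc ‖f w‖ = ‖G (Complex.I * w)‖ * Real.exp (-(τ * w.re)) := by rw [hf, norm_mul, hexp]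
        _ ≤ A * Real.exp (τ * w.re) * Real.exp (-(τ * w.re)) := by gcongr
        _ = A := by rw [mul_assoc, ← Real.exp_add]; simp
    have h2 : ‖f (-Complex.I * z)‖ ≤ C := by
      refine PhragmenLindelof.right_half_plane_of_bounded_on_real hfd.diffContOnCl
        ⟨1, by norm_num, 0, ?_⟩ ?_ ?_ ?_
      · refine Asymptotics.IsBigO.of_bound A ?_
        rw [eventually_inf_principal]
        refine Eventually.of_forall fun w hw => ?_
        simpa using hfA w (le_of_lt hw)
      · refine ⟨A, ?_⟩
        rw [eventually_map]
        filter_upwards [eventually_ge_atTop 0] with t ht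
        exact hfA t (by simpa using ht)
      · intro t
        have h3 : Complex.I * (t * Complex.I) = ((-t : ℝ) : ℂ) := by
          push_cast
          linear_combination (t : ℂ) * Complex.I_mul_I
        rw [hf, norm_mul, hexp, h3]
        simpa using hC (-t)
      · simpa using hz
    have h4 : Complex.I * (-Complex.I * z) = z := by
      linear_combination (-z) * Complex.I_mul_I
    rw [hf, norm_mul, hexp, h4] at h2
    have h5 : (-Complex.I * z).re = z.im := by simp
    rw [h5, Real.exp_neg, ← div_eq_mul_inv, div_le_iff₀ (Real.exp_pos _)] at h2
    rwa [abs_of_nonneg hz]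
  rcases le_total 0 z.im with h | h
  · exact half hd hA hC z h
  · have := half (G := fun w => F (-w)) (hd.comp differentiable_neg)
      (fun w => by simpa using hA (-w)) (fun t => by simpa using hC (-t)) (-z) (by simpa using h)
    simpa using this

/-- Relabel so that index `0` is the last node not exceeding `t`, which exists because separation
drives the nodes to both infinities. Iterating the gap bound on either side gives `|x (i + p) - t| ≤
n δ`. -/
theorem StrictMono.exists_centredNodes {γ δ : ℝ} (hγ : 0 < γ) {ν : ℕ} {x : ℤ → ℝ}
    (hmono : StrictMono x) (hsep : SeparatedBy γ x) (hgap : ∀ i, x (i + ν) - x i ≤ δ) (t : ℝ) :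
    ∃ p : ℤ, CentredNodes γ ν δ fun i => x (i + p) - t := by
  have hstep (i : ℤ) : x i + γ ≤ x (i + 1) := by
    have h1 := hsep (i + 1) i (by omega)
    rw [abs_of_pos (sub_pos.mpr (hmono (lt_add_one i)))] at h1
    linarith
  have hup (n : ℕ) (i : ℤ) : x i + n * γ ≤ x (i + n) := by
    induction n with
    | zero => simp
    | succ n ih =>
      have := hstep (i + n)
      push_cast
      rw [← add_assoc]
      linarith
  have hgaps (n : ℕ) (i : ℤ) : x (i + n * ν) ≤ x i + n * δ := by
    induction n with
    | zero => simp
    | succ n ih =>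
      have := hgap (i + n * ν)
      have h2 : i + ((n + 1 : ℕ) : ℤ) * ν = i + n * ν + ν := by push_cast; ring
      rw [h2]
      push_cast
      linarith
  obtain ⟨p, hp, hpmax⟩ := Int.exists_greatest_of_bdd (P := fun i => x i ≤ t) (by
      obtain ⟨n, hn⟩ := exists_nat_gt ((t - x 0) / γ)
      rw [div_lt_iff₀ hγ] at hn
      refine ⟨n, fun i hi => ?_⟩
      by_contra! hlt
      have h1 := hup n 0
      rw [zero_add] at h1
      linarith [hmono hlt]) (by
      obtain ⟨n, hn⟩ := exists_nat_gt ((x 0 - t) / γ)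
      rw [div_lt_iff₀ hγ] at hn
      refine ⟨-n, ?_⟩
      have h1 := hup n (-n)
      rw [neg_add_cancel] at h1
      linarith)
  have hp1 : t < x (p + 1) := by
    by_contra! h
    have := hpmax _ h
    omega
  refine ⟨p, fun i j hij => ?_, fun n i h1 h2 => ?_⟩
  · have := hsep (i + p) (j + p) (by omega)
    simpa using this
  · rw [abs_le]
    constructor
    · have h3 := hgaps n (p + 1 - n * ν)
      rw [sub_add_cancel] at h3
      have h4 : x (p + 1 - n * ν) ≤ x (i + p) := hmono.monotone (by omega)
      linarith
    · have h3 := hgaps n p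
      have h4 : x (i + p) ≤ x (p + n * ν) := hmono.monotone (by omega)
      linarith

/-- Sup-norm sampling inequality, with constant depending only on the density data. -/
theorem exists_mul_norm_le_norm_iteratedDeriv {τ : ℝ} (hτ : 0 ≤ τ) {γ δ : ℝ} (hγ : 0 < γ)
    (hδ : 0 < δ) {ν k : ℕ} (hν : 1 ≤ ν) (hk : 1 ≤ k) (hdens : τ * δ < k * ν * Real.pi) :
    ∃ ε : ℝ, 0 < ε ∧ ∀ (F : ℂ → ℂ) (A : ℝ) (x : ℤ → ℝ), Differentiable ℂ F →
      (∀ z, ‖F z‖ ≤ A * Real.exp (τ * |z.im|)) → StrictMono x → SeparatedBy γ x →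
      (∀ i, x (i + ν) - x i ≤ δ) → ∀ s : ℝ, ∃ i, ∃ l < k,
        ε * ‖F s‖ ≤ ‖iteratedDeriv l F (x i : ℂ)‖ := by
  obtain ⟨ε, hε, h⟩ := exists_le_norm_iteratedDeriv_of_centredNodes hτ hγ hδ hν hk hdens
  refine ⟨ε, hε, fun F A x hd hA hmono hsep hgap s => ?_⟩
  have hreal (t : ℝ) : ‖F t‖ ≤ A := by simpa using hA t
  have hbdd : BddAbove (Set.range fun t : ℝ => ‖F t‖) := ⟨A, by rintro _ ⟨t, rfl⟩; exact hreal t⟩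
  set M : ℝ := ⨆ t : ℝ, ‖F t‖ with hM
  have hleM (t : ℝ) : ‖F t‖ ≤ M := le_ciSup hbdd t
  rcases (norm_nonneg (F s)).eq_or_lt with h0 | h0
  · exact ⟨0, 0, by omega, by rw [← h0, mul_zero]; exact norm_nonneg _⟩
  have hMpos : 0 < M := h0.trans_le (hleM s)
  -- The supremum need not be attained; recentring at a point above half of it and dividing by `M`
  -- gives a function of modulus at least `1/2` at `0`.
  obtain ⟨t, ht⟩ := exists_lt_of_lt_ciSup (half_lt_self hMpos)
  obtain ⟨p, hp⟩ := hmono.exists_centredNodes hγ hsep hgap t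
  have hMb := norm_le_mul_exp_of_bounded_on_real hd hA hleM
  obtain ⟨i, l, hl, hil⟩ := h (fun z => (M⁻¹ : ℂ) * F (z + t)) _
    ((hd.comp (differentiable_id.add_const _)).const_mul _) (fun z => by
      have h1 := hMb (z + t)
      rw [Complex.add_im, Complex.ofReal_im, add_zero] at h1
      rw [norm_mul, norm_inv, Complex.norm_real, Real.norm_of_nonneg hMpos.le,
        inv_mul_le_iff₀ hMpos]
      exact h1) hp (by
      rw [norm_mul, norm_inv, Complex.norm_real, Real.norm_of_nonneg hMpos.le, zero_add,
        inv_mul_eq_div, le_div_iff₀ hMpos]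
      linarith)
  refine ⟨i + p, l, hl, ?_⟩
  rw [iteratedDeriv_const_mul_field, iteratedDeriv_comp_add_const, norm_mul, norm_inv,
    Complex.norm_real, Real.norm_of_nonneg hMpos.le, inv_mul_eq_div, le_div_iff₀ hMpos] at hil
  have h2 : ((x (i + p) - t : ℝ) : ℂ) + t = x (i + p) := by push_cast; ring
  simp only [h2] at hil
  calc ε * ‖F s‖ ≤ ε * M := by
        gcongr
        exact hleM s
    _ ≤ _ := hil

end SupSampling

/-! ### A decaying window of small exponential type. -/

section Window

theorem Complex.norm_sin_le_exp (z : ℂ) : ‖Complex.sin z‖ ≤ Real.exp |z.im| := by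
  rw [Complex.sin, norm_div, norm_mul, Complex.norm_I, mul_one]
  have h1 : ‖Complex.exp (-z * Complex.I)‖ ≤ Real.exp |z.im| := by
    rw [Complex.norm_exp]
    gcongr
    simpa using le_abs_self z.im
  have h2 : ‖Complex.exp (z * Complex.I)‖ ≤ Real.exp |z.im| := by
    rw [Complex.norm_exp]
    gcongr
    simpa using neg_le_abs z.im
  have h3 := norm_sub_le (Complex.exp (-z * Complex.I)) (Complex.exp (z * Complex.I))
  rw [Complex.norm_ofNat]
  linarith

theorem exists_norm_dslope_sin_le : ∃ C : ℝ, 0 < C ∧ ∀ z : ℂ,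
    ‖dslope Complex.sin 0 z‖ * (1 + ‖z‖) ≤ C * Real.exp |z.im| := by
  have hd : Differentiable ℂ (dslope Complex.sin 0) := by
    rw [← differentiableOn_univ, Complex.differentiableOn_dslope Filter.univ_mem]
    exact Complex.differentiable_sin.differentiableOn
  obtain ⟨C, hC⟩ := (isCompact_closedBall (0 : ℂ) 1).exists_bound_of_continuousOn
    hd.continuous.continuousOn
  refine ⟨max (C * 2) 2, by positivity, fun z => ?_⟩
  have hexp : 1 ≤ Real.exp |z.im| := Real.one_le_exp (abs_nonneg _)
  rcases le_or_gt ‖z‖ 1 with h | h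
  · have h1 := hC z (by simpa using h)
    have hC0 : 0 ≤ C := (norm_nonneg _).trans h1
    calc ‖dslope Complex.sin 0 z‖ * (1 + ‖z‖) ≤ C * 2 := by
          gcongr
          linarith
      _ ≤ max (C * 2) 2 * 1 := by rw [mul_one]; exact le_max_left _ _
      _ ≤ _ := by gcongr
  · have hz : z ≠ 0 := by
      rintro rfl
      simp at h
      linarith
    rw [dslope_of_ne _ hz, slope_def_field]
    simp only [Complex.sin_zero, sub_zero, norm_div]
    have hz0 : 0 < ‖z‖ := by linarith
    calc ‖Complex.sin z‖ / ‖z‖ * (1 + ‖z‖) ≤ Real.exp |z.im| / ‖z‖ * (‖z‖ + ‖z‖) := by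
          gcongr
          exact Complex.norm_sin_le_exp z
      _ = 2 * Real.exp |z.im| := by field_simp; ring
      _ ≤ _ := by gcongr; exact le_max_right _ _

/-- An entire function of small exponential type, equal to `1` at `0`, all of whose derivatives
decay on the real axis. -/
theorem exists_window {η : ℝ} (hη : 0 < η) (k : ℕ) : ∃ (h : ℂ → ℂ) (A : ℝ), 0 < A ∧
    Differentiable ℂ h ∧ h 0 = 1 ∧ (∀ z, ‖h z‖ ≤ A * Real.exp (η * |z.im|)) ∧
    ∀ l < k, ∀ t : ℝ, ‖iteratedDeriv l h t‖ ≤ A / (1 + |t|) := by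
  obtain ⟨C, hC, hb⟩ := exists_norm_dslope_sin_le
  have hd0 : Differentiable ℂ (dslope Complex.sin 0) := by
    rw [← differentiableOn_univ, Complex.differentiableOn_dslope Filter.univ_mem]
    exact Complex.differentiable_sin.differentiableOn
  set h : ℂ → ℂ := fun z => dslope Complex.sin 0 (η * z) with hh
  have hd : Differentiable ℂ h := hd0.comp (differentiable_id.const_mul _)
  have hb' (z : ℂ) : ‖h z‖ * (1 + η * ‖z‖) ≤ C * Real.exp (η * |z.im|) := by
    have h1 := hb (η * z)
    rwa [norm_mul, Complex.norm_real, Real.norm_of_nonneg hη.le, Complex.im_ofReal_mul, abs_mul,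
      abs_of_pos hη] at h1
  have hb1 (z : ℂ) : ‖h z‖ ≤ C * Real.exp (η * |z.im|) := by
    refine le_trans ?_ (hb' z)
    exact le_mul_of_one_le_right (norm_nonneg _) (by linarith [mul_nonneg hη.le (norm_nonneg z)])
  -- Cauchy's estimate on a unit circle transfers the decay to derivatives: `exp η` covers `|Im z| ≤
  -- 1`, and `2 (1 + 1/η)` compares `1 + |t|` with `1 + η ‖z‖`.
  set K : ℝ := C * Real.exp η * (2 * (1 + 1 / η)) with hK
  have hcauchy (l : ℕ) (t : ℝ) :
      ‖iteratedDeriv l h t‖ ≤ l.factorial * (K / (1 + |t|)) / 1 ^ l := by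
    refine Complex.norm_iteratedDeriv_le_of_forall_mem_sphere_norm_le l one_pos hd.diffContOnCl
      fun z hz => ?_
    have hz1 : ‖z - t‖ = 1 := by simpa using hz
    have him : |z.im| ≤ 1 := by
      have := Complex.abs_im_le_norm (z - t)
      rw [hz1] at this
      simpa using this
    have htz : |t| ≤ 1 + ‖z‖ := by
      have h1 : ‖(t : ℂ)‖ ≤ ‖z - t‖ + ‖z‖ := by
        have := norm_sub_le z (z - t)
        rw [sub_sub_cancel] at this
        linarith
      rw [hz1] at h1
      simpa using h1
    rw [le_div_iff₀ (by positivity)]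
    have h3 : ‖h z‖ * (1 + η * ‖z‖) ≤ C * Real.exp η := by
      refine (hb' z).trans ?_
      gcongr
      nlinarith
    have h4 : 1 + |t| ≤ (1 + η * ‖z‖) * (2 * (1 + 1 / η)) := by
      have h5 : (1 + η * ‖z‖) * (2 * (1 + 1 / η)) =
          2 + 2 / η + 2 * (η * ‖z‖) + 2 * ‖z‖ := by
        field_simp
        ring
      rw [h5]
      linarith [mul_nonneg hη.le (norm_nonneg z), div_pos two_pos hη, norm_nonneg z]
    calc ‖h z‖ * (1 + |t|) ≤ ‖h z‖ * ((1 + η * ‖z‖) * (2 * (1 + 1 / η))) := by gcongr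
      _ = ‖h z‖ * (1 + η * ‖z‖) * (2 * (1 + 1 / η)) := by ring
      _ ≤ K := by
        rw [hK]
        gcongr
  have hK0 : 0 < K := by positivity
  have hkf : (0 : ℝ) < k.factorial := by exact_mod_cast k.factorial_pos
  refine ⟨h, k.factorial * K + C, by positivity, hd, ?_, fun z => ?_, fun l hl t => ?_⟩
  · simp [hh, dslope_same]
  · refine (hb1 z).trans ?_
    gcongr
    linarith [mul_pos hkf hK0]
  · refine (hcauchy l t).trans ?_
    rw [one_pow, div_one, ← mul_div_assoc]
    gcongr
    have h1 : (l.factorial : ℝ) ≤ k.factorial := by exact_mod_cast Nat.factorial_le hl.le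
    nlinarith

end Window

/-! ### Lower and upper sampling inequalities in `L²`. -/

section LTwoSampling

theorem sq_sum_range_le (k : ℕ) (a : ℕ → ℝ) :
    (∑ m ∈ Finset.range k, a m) ^ 2 ≤ k * ∑ m ∈ Finset.range k, a m ^ 2 := by
  simpa using sq_sum_le_card_mul_sum_sq (s := Finset.range k) (f := a)

/-- Lower `L²` sampling inequality, with constant depending only on the density data. -/
theorem exists_lintegral_le_tsum_sampling {σ : ℝ} (hσ : 0 ≤ σ) {γ δ : ℝ} (hγ : 0 < γ)
    (hδ : 0 < δ) {ν k : ℕ} (hν : 1 ≤ ν) (hk : 1 ≤ k) (hdens : σ * δ < k * ν * Real.pi) :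
    ∃ K : ℝ, 0 < K ∧ ∀ (F : ℂ → ℂ) (A : ℝ) (x : ℤ → ℝ), Differentiable ℂ F →
      (∀ z, ‖F z‖ ≤ A * Real.exp (σ * |z.im|)) → StrictMono x → SeparatedBy γ x →
      (∀ i, x (i + ν) - x i ≤ δ) →
      ∫⁻ s : ℝ, ENNReal.ofReal (‖F s‖ ^ 2) ≤ ENNReal.ofReal K *
        ∑' i, ENNReal.ofReal (∑ l ∈ Finset.range k, ‖iteratedDeriv l F (x i : ℂ)‖ ^ 2) := by
  -- The window may use up half of the slack in the density inequality.
  obtain ⟨η, hη, hdens'⟩ : ∃ η : ℝ, 0 < η ∧ (σ + η) * δ < k * ν * Real.pi := by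
    refine ⟨(k * ν * Real.pi - σ * δ) / (2 * δ), by
      have : 0 < k * ν * Real.pi - σ * δ := by linarith
      positivity, ?_⟩
    have h1 : (σ + (k * ν * Real.pi - σ * δ) / (2 * δ)) * δ =
        σ * δ + (k * ν * Real.pi - σ * δ) / 2 := by field_simp
    rw [h1]
    linarith
  obtain ⟨ε, hε, hsamp⟩ := exists_mul_norm_le_norm_iteratedDeriv (τ := σ + η) (by linarith) hγ hδ
    hν hk hdens'
  obtain ⟨h, B, hB, hhd, hh0, hhb, hhdec⟩ := exists_window hη k
  set c : ℝ := (2 ^ k * B / ε) ^ 2 * k with hc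
  have hk0 : (0 : ℝ) < k := by exact_mod_cast hk
  have hc0 : 0 < c := by positivity
  refine ⟨c * Real.pi, by positivity, fun F A x hd hA hmono hsep hgap => ?_⟩
  set S : ℤ → ℝ := fun i => ∑ l ∈ Finset.range k, ‖iteratedDeriv l F (x i : ℂ)‖ ^ 2 with hS
  have hS0 (i : ℤ) : 0 ≤ S i := Finset.sum_nonneg fun l _ => sq_nonneg _
  -- Apply the sup-norm inequality to `F(z) h(z - s)`, which equals `F s` at `s`. Leibniz's rule and
  -- the decay of `h` weight the samples by distance to `s`; `2^k` bounds the binomials, and the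
  -- factor `k` is Cauchy–Schwarz.
  have hpt (s : ℝ) : ∃ i, ‖F s‖ ^ 2 ≤ c * S i * (1 + (x i - s) ^ 2)⁻¹ := by
    obtain ⟨i, l, hl, hil⟩ := hsamp (F * fun z => h (z - s)) (A * B) x
      (hd.mul (hhd.comp (differentiable_id.sub_const _))) (fun z => by
        have h1 := hhb (z - s)
        rw [Complex.sub_im, Complex.ofReal_im, sub_zero] at h1
        rw [Pi.mul_apply, norm_mul]
        calc ‖F z‖ * ‖h (z - s)‖ ≤
            (A * Real.exp (σ * |z.im|)) * (B * Real.exp (η * |z.im|)) :=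
              mul_le_mul (hA z) h1 (norm_nonneg _) ((norm_nonneg _).trans (hA z))
          _ = A * B * Real.exp ((σ + η) * |z.im|) := by
              rw [add_mul, Real.exp_add]
              ring) hmono hsep hgap s
    refine ⟨i, ?_⟩
    have hcdF (n : ℕ) : ContDiffAt ℂ n F (x i) := hd.contDiff.contDiffAt
    have hcdh (n : ℕ) : ContDiffAt ℂ n (fun z => h (z - s)) (x i) :=
      (hhd.comp (differentiable_id.sub_const (s : ℂ))).contDiff.contDiffAt
    rw [Pi.mul_apply, sub_self, hh0, mul_one, iteratedDeriv_mul (hcdF l) (hcdh l)] at hil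
    set w : ℝ := 1 + |x i - s| with hw
    have hw0 : 0 < w := by positivity
    have h2 : ε * ‖F s‖ ≤ 2 ^ k * (B / w) * ∑ m ∈ Finset.range k, ‖iteratedDeriv m F (x i)‖ := by
      refine hil.trans ((norm_sum_le _ _).trans ?_)
      rw [Finset.mul_sum]
      refine le_trans ?_ (Finset.sum_le_sum_of_subset_of_nonneg (s := Finset.range (l + 1))
        (Finset.range_subset_range.mpr hl) fun m _ _ => by positivity)
      refine Finset.sum_le_sum fun m hm => ?_
      have hml : m ≤ l := Nat.lt_succ_iff.mp (Finset.mem_range.mp hm)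
      rw [norm_mul, norm_mul, iteratedDeriv_comp_sub_const, RCLike.norm_natCast]
      have h3 : ‖iteratedDeriv (l - m) h ((x i : ℂ) - s)‖ ≤ B / w := by
        have := hhdec (l - m) (by omega) (x i - s)
        rwa [Complex.ofReal_sub] at this
      have h4 : (l.choose m : ℝ) ≤ 2 ^ k := by
        calc (l.choose m : ℝ) ≤ ((2 ^ l : ℕ) : ℝ) := by exact_mod_cast Nat.choose_le_two_pow l m
          _ ≤ 2 ^ k := by
            push_cast
            exact pow_le_pow_right₀ one_le_two hl.le
      calc (l.choose m : ℝ) * ‖iteratedDeriv m F (x i)‖ * ‖iteratedDeriv (l - m) h ((x i : ℂ) - s)‖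
          ≤ 2 ^ k * ‖iteratedDeriv m F (x i)‖ * (B / w) := by gcongr
        _ = _ := by ring
    have h5 : ‖F s‖ ≤ 2 ^ k * B / ε / w * ∑ m ∈ Finset.range k, ‖iteratedDeriv m F (x i)‖ := by
      calc ‖F s‖ = (ε * ‖F s‖) / ε := by field_simp
        _ ≤ (2 ^ k * (B / w) * ∑ m ∈ Finset.range k, ‖iteratedDeriv m F (x i)‖) / ε := by gcongr
        _ = _ := by ring
    have h6 : (w ^ 2)⁻¹ ≤ (1 + (x i - s) ^ 2)⁻¹ := by
      gcongr
      rw [hw, ← sq_abs (x i - s)]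
      nlinarith [abs_nonneg (x i - s)]
    calc ‖F s‖ ^ 2
        ≤ (2 ^ k * B / ε / w * ∑ m ∈ Finset.range k, ‖iteratedDeriv m F (x i)‖) ^ 2 := by gcongr
      _ = (2 ^ k * B / ε) ^ 2 * (w ^ 2)⁻¹ *
          (∑ m ∈ Finset.range k, ‖iteratedDeriv m F (x i)‖) ^ 2 := by
        rw [mul_pow, div_pow _ w, div_eq_mul_inv]
      _ ≤ (2 ^ k * B / ε) ^ 2 * (1 + (x i - s) ^ 2)⁻¹ * (k * S i) := by
        gcongr
        exact sq_sum_range_le k _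
      _ = c * S i * (1 + (x i - s) ^ 2)⁻¹ := by rw [hc]; ring
  have hint : ∫⁻ t : ℝ, ENNReal.ofReal ((1 + t ^ 2)⁻¹) = ENNReal.ofReal Real.pi := by
    rw [← ofReal_integral_eq_lintegral_ofReal integrable_inv_one_add_sq
      (Filter.Eventually.of_forall fun t => by positivity), integral_univ_inv_one_add_sq]
  have hmeas (i : ℤ) : Measurable fun s : ℝ =>
      ENNReal.ofReal (c * S i) * ENNReal.ofReal ((1 + (x i - s) ^ 2)⁻¹) := by fun_prop
  calc ∫⁻ s : ℝ, ENNReal.ofReal (‖F s‖ ^ 2)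
      ≤ ∫⁻ s : ℝ, ∑' i, ENNReal.ofReal (c * S i) * ENNReal.ofReal ((1 + (x i - s) ^ 2)⁻¹) := by
        refine lintegral_mono fun s => ?_
        obtain ⟨i, hi⟩ := hpt s
        -- The good node depends on `s`; bounding by the sum over all nodes removes this dependence
        -- and any measurability question.
        refine le_trans ?_ (ENNReal.le_tsum i)
        rw [← ENNReal.ofReal_mul (by have := hS0 i; positivity)]
        exact ENNReal.ofReal_le_ofReal hi
    _ = ∑' i, ENNReal.ofReal (c * S i) * ENNReal.ofReal Real.pi := by
        rw [lintegral_tsum fun i => (hmeas i).aemeasurable]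
        refine tsum_congr fun i => ?_
        rw [lintegral_const_mul _ (by fun_prop),
          lintegral_sub_left_eq_self (fun t : ℝ => ENNReal.ofReal ((1 + t ^ 2)⁻¹)) (x i), hint]
    _ = _ := by
        rw [← ENNReal.tsum_mul_left]
        refine tsum_congr fun i => ?_
        rw [← ENNReal.ofReal_mul (by have := hS0 i; positivity),
          ← ENNReal.ofReal_mul (by positivity)]
        congr 1
        ring

theorem sq_integral_norm_le {v : ℝ → ℂ} (hv : Continuous v) {a γ : ℝ} (hγ : 0 < γ) :
    (∫ t in a..a + γ, ‖v t‖) ^ 2 ≤ γ * ∫ t in a..a + γ, ‖v t‖ ^ 2 := by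
  set J := ∫ t in a..a + γ, ‖v t‖ with hJ
  have hi1 : IntervalIntegrable (fun t => ‖v t‖ ^ 2) volume a (a + γ) :=
    (hv.norm.pow 2).intervalIntegrable _ _
  have hi2 : IntervalIntegrable (fun t => 2 * (J / γ) * ‖v t‖) volume a (a + γ) :=
    (continuous_const.mul hv.norm).intervalIntegrable _ _
  have h1 : 0 ≤ ∫ t in a..a + γ, (‖v t‖ - J / γ) ^ 2 :=
    intervalIntegral.integral_nonneg (by linarith) fun t _ => sq_nonneg _
  have h2 (t : ℝ) : (‖v t‖ - J / γ) ^ 2 = ‖v t‖ ^ 2 - 2 * (J / γ) * ‖v t‖ + (J / γ) ^ 2 := by ring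
  simp_rw [h2] at h1
  rw [intervalIntegral.integral_add (hi1.sub hi2) (by simp),
    intervalIntegral.integral_sub hi1 hi2, intervalIntegral.integral_const_mul, ← hJ,
    intervalIntegral.integral_const] at h1
  simp only [add_sub_cancel_left, smul_eq_mul] at h1
  have h3 : γ * (J / γ) ^ 2 = J ^ 2 / γ := by field_simp
  have h4 : 2 * (J / γ) * J = 2 * (J ^ 2 / γ) := by ring
  rw [h3, h4] at h1
  have h5 : J ^ 2 / γ ≤ ∫ t in a..a + γ, ‖v t‖ ^ 2 := by linarith
  rwa [div_le_iff₀' hγ] at h5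

/-- A local Sobolev inequality: compare `u a` with `u t` by the fundamental theorem of calculus,
apply Cauchy–Schwarz to `∫ ‖v‖`, and average over `t`. -/
theorem mul_norm_sq_le_integral {u v : ℝ → ℂ} (hu : ∀ t, HasDerivAt u (v t) t) (hv : Continuous v)
    {γ : ℝ} (hγ : 0 < γ) (a : ℝ) :
    γ * ‖u a‖ ^ 2 ≤ ∫ t in a..a + γ, (2 * ‖u t‖ ^ 2 + 2 * γ ^ 2 * ‖v t‖ ^ 2) := by
  have huc : Continuous u := continuous_iff_continuousAt.mpr fun t => (hu t).continuousAt
  set J := ∫ t in a..a + γ, ‖v t‖ ^ 2 with hJ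
  have hpt (t : ℝ) (ht : t ∈ Set.Icc a (a + γ)) : ‖u a‖ ^ 2 ≤ 2 * ‖u t‖ ^ 2 + 2 * γ * J := by
    have h1 : ∫ s in a..t, v s = u t - u a :=
      intervalIntegral.integral_eq_sub_of_hasDerivAt (fun s _ => hu s) (hv.intervalIntegrable _ _)
    have h2 : ‖∫ s in a..t, v s‖ ≤ ∫ s in a..a + γ, ‖v s‖ := by
      refine (intervalIntegral.norm_integral_le_integral_norm ht.1).trans ?_
      exact intervalIntegral.integral_mono_interval le_rfl ht.1 ht.2
        (Filter.Eventually.of_forall fun s => norm_nonneg _) (hv.norm.intervalIntegrable _ _)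
    have h3 : ‖u a‖ ≤ ‖u t‖ + ∫ s in a..a + γ, ‖v s‖ := by
      have h4 : u a = u t - ∫ s in a..t, v s := by rw [h1]; ring
      rw [h4]
      exact (norm_sub_le _ _).trans (by gcongr)
    have h5 := sq_integral_norm_le hv hγ (a := a)
    rw [← hJ] at h5
    have h6 : ‖u a‖ ^ 2 ≤ (‖u t‖ + ∫ s in a..a + γ, ‖v s‖) ^ 2 := by gcongr
    nlinarith [sq_nonneg (‖u t‖ - ∫ s in a..a + γ, ‖v s‖)]
  have h1 : ∫ _ in a..a + γ, ‖u a‖ ^ 2 ≤ ∫ t in a..a + γ, (2 * ‖u t‖ ^ 2 + 2 * γ * J) := by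
    refine intervalIntegral.integral_mono_on (by linarith) (by simp) ?_ hpt
    exact Continuous.intervalIntegrable (by fun_prop) _ _
  have hi1 : IntervalIntegrable (fun t => 2 * ‖u t‖ ^ 2) volume a (a + γ) :=
    Continuous.intervalIntegrable (by fun_prop) _ _
  have hi2 : IntervalIntegrable (fun t => 2 * γ ^ 2 * ‖v t‖ ^ 2) volume a (a + γ) :=
    Continuous.intervalIntegrable (by fun_prop) _ _
  rw [intervalIntegral.integral_const, intervalIntegral.integral_add hi1 (by simp),
    intervalIntegral.integral_const] at h1
  rw [intervalIntegral.integral_add hi1 hi2, intervalIntegral.integral_const_mul (2 * γ ^ 2), ← hJ]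
  simp only [add_sub_cancel_left, smul_eq_mul] at h1
  linarith

/-- Upper sampling inequality along a separated sequence. -/
theorem tsum_norm_sq_le_lintegral {u v : ℝ → ℂ} (hu : ∀ t, HasDerivAt u (v t) t)
    (hv : Continuous v) {γ : ℝ} (hγ : 0 < γ) {x : ℤ → ℝ} (hx : SeparatedBy γ x) :
    ∑' i, ENNReal.ofReal (‖u (x i)‖ ^ 2) ≤ ENNReal.ofReal γ⁻¹ *
      ∫⁻ t, ENNReal.ofReal (2 * ‖u t‖ ^ 2 + 2 * γ ^ 2 * ‖v t‖ ^ 2) := by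
  have huc : Continuous u := continuous_iff_continuousAt.mpr fun t => (hu t).continuousAt
  set f : ℝ → ℝ := fun t => 2 * ‖u t‖ ^ 2 + 2 * γ ^ 2 * ‖v t‖ ^ 2 with hf
  have hfc : Continuous f := by fun_prop
  have hf0 (t : ℝ) : 0 ≤ f t := by positivity
  have hterm (i : ℤ) : ENNReal.ofReal (‖u (x i)‖ ^ 2) ≤ ENNReal.ofReal γ⁻¹ *
      ∫⁻ t in Set.Ioc (x i) (x i + γ), ENNReal.ofReal (f t) := by
    have h1 := mul_norm_sq_le_integral hu hv hγ (x i)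
    rw [intervalIntegral.integral_of_le (by linarith)] at h1
    rw [← ofReal_integral_eq_lintegral_ofReal
      ((hfc.integrableOn_Icc (a := x i) (b := x i + γ)).mono_set Set.Ioc_subset_Icc_self)
      (Filter.Eventually.of_forall hf0), ← ENNReal.ofReal_mul (by positivity)]
    refine ENNReal.ofReal_le_ofReal ?_
    rw [inv_mul_eq_div, le_div_iff₀ hγ, mul_comm]
    exact h1
  have hdisj : Pairwise (Function.onFun Disjoint fun i : ℤ => Set.Ioc (x i) (x i + γ)) := by
    intro i j hij
    rw [Function.onFun, Set.disjoint_left]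
    rintro t ⟨h1, h2⟩ ⟨h3, h4⟩
    have h5 := hx i j hij
    rcases le_abs.mp h5 with h | h <;> linarith
  calc ∑' i, ENNReal.ofReal (‖u (x i)‖ ^ 2)
      ≤ ∑' i, ENNReal.ofReal γ⁻¹ * ∫⁻ t in Set.Ioc (x i) (x i + γ), ENNReal.ofReal (f t) :=
        ENNReal.tsum_le_tsum hterm
    _ = ENNReal.ofReal γ⁻¹ * ∫⁻ t in ⋃ i, Set.Ioc (x i) (x i + γ), ENNReal.ofReal (f t) := by
        rw [ENNReal.tsum_mul_left, lintegral_iUnion (fun i => measurableSet_Ioc) hdisj]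
    _ ≤ _ := by
        gcongr
        exact Measure.restrict_le_self

end LTwoSampling

/-! ### Band-limited functions and their samples -/

/-! ### The `L²` Fourier transform agrees with the integral on `L¹ ∩ L²`. -/

section Plancherel

open SchwartzMap

theorem ae_eq_of_forall_integral_schwartz_eq {F h : ℝ → ℂ} (hF : LocallyIntegrable F)
    (hh : LocallyIntegrable h) (H : ∀ s : 𝓢(ℝ, ℂ), ∫ x, s x • F x = ∫ x, s x • h x) :
    F =ᵐ[volume] h := by
  refine ae_eq_of_integral_contDiff_smul_eq hF hh fun u hu hcs => ?_
  have hcs' : HasCompactSupport (fun x => (u x : ℂ)) := hcs.comp_left Complex.ofReal_zero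
  have := H (hcs'.toSchwartzMap (Complex.ofRealCLM.contDiff.comp hu))
  simpa [HasCompactSupport.toSchwartzMap] using! this

/-- Both transforms have the same pairings with Schwartz functions: one by the distributional
definition, the other by Fubini. -/
theorem coeFn_fourier_toLp {f : ℝ → ℂ} (h1 : Integrable f) (h2 : MemLp f 2) :
    (𝓕 (h2.toLp f) : Lp ℂ 2 (volume : Measure ℝ)) =ᵐ[volume] 𝓕 f := by
  have hcont : Continuous (𝓕 f) := VectorFourier.fourierIntegral_continuous
    Real.continuous_fourierChar continuous_inner h1
  refine ae_eq_of_forall_integral_schwartz_eq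
    ((Lp.memLp _).locallyIntegrable one_le_two) hcont.locallyIntegrable fun s => ?_
  rw [← Lp.toTemperedDistribution_apply, ← Lp.fourier_toTemperedDistribution_eq,
    TemperedDistribution.fourier_apply, Lp.toTemperedDistribution_apply]
  have e : ∫ x, (𝓕 s : 𝓢(ℝ, ℂ)) x • (h2.toLp f) x = ∫ x, (𝓕 s : 𝓢(ℝ, ℂ)) x • f x :=
    integral_congr_ae (by filter_upwards [h2.coeFn_toLp] with x hx; rw [hx])
  rw [e]
  simpa using! VectorFourier.integral_fourierIntegral_smul_eq_flip (L := innerₗ ℝ)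
    Real.continuous_fourierChar continuous_inner s.integrable h1

theorem coeFn_fourierInv_toLp {f : ℝ → ℂ} (h1 : Integrable f) (h2 : MemLp f 2) :
    (𝓕⁻ (h2.toLp f) : Lp ℂ 2 (volume : Measure ℝ)) =ᵐ[volume] 𝓕⁻ f := by
  have hL : Continuous fun p : ℝ × ℝ => (-innerₗ ℝ) p.1 p.2 := by
    simp only [LinearMap.neg_apply]
    exact continuous_inner.neg
  have hcont : Continuous (𝓕⁻ f) := VectorFourier.fourierIntegral_continuous
    Real.continuous_fourierChar hL h1
  refine ae_eq_of_forall_integral_schwartz_eq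
    ((Lp.memLp _).locallyIntegrable one_le_two) hcont.locallyIntegrable fun s => ?_
  rw [← Lp.toTemperedDistribution_apply, ← Lp.fourierInv_toTemperedDistribution_eq,
    TemperedDistribution.fourierInv_apply, Lp.toTemperedDistribution_apply]
  have e : ∫ x, (𝓕⁻ s : 𝓢(ℝ, ℂ)) x • (h2.toLp f) x = ∫ x, (𝓕⁻ s : 𝓢(ℝ, ℂ)) x • f x :=
    integral_congr_ae (by filter_upwards [h2.coeFn_toLp] with x hx; rw [hx])
  rw [e]
  have := VectorFourier.integral_fourierIntegral_smul_eq_flip (L := -innerₗ ℝ)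
    Real.continuous_fourierChar hL (s.integrable (μ := volume)) h1
  have hflip : (-innerₗ ℝ).flip = -innerₗ ℝ := by
    ext; simp
  rw [hflip] at this
  rw [SchwartzMap.fourierInv_coe s]
  exact this

theorem memLp_fourierInv {f : ℝ → ℂ} (h1 : Integrable f) (h2 : MemLp f 2) : MemLp (𝓕⁻ f) 2 :=
  (Lp.memLp (𝓕⁻ (h2.toLp f) : Lp ℂ 2 (volume : Measure ℝ))).ae_eq (coeFn_fourierInv_toLp h1 h2)

theorem toLp_fourierInv {f : ℝ → ℂ} (h1 : Integrable f) (h2 : MemLp f 2) (h : MemLp (𝓕⁻ f) 2) :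
    h.toLp (𝓕⁻ f) = 𝓕⁻ (h2.toLp f) :=
  Lp.ext (h.coeFn_toLp.trans (coeFn_fourierInv_toLp h1 h2).symm)

end Plancherel

theorem MeasureTheory.MemLp.lintegral_norm_sq {f : ℝ → ℂ} (h : MemLp f 2) :
    ∫⁻ t, ENNReal.ofReal (‖f t‖ ^ 2) = ENNReal.ofReal (‖h.toLp f‖ ^ 2) := by
  rw [← ofReal_integral_eq_lintegral_ofReal ((memLp_two_iff_integrable_sq_norm h.1).1 h)
    (ae_of_all _ fun _ => by positivity)]
  congr 1
  rw [@norm_sq_eq_re_inner ℂ, L2.inner_def, ← integral_re (L2.integrable_inner _ _)]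
  refine integral_congr_ae ?_
  filter_upwards [h.coeFn_toLp] with t ht
  rw [ht, ← @norm_sq_eq_re_inner ℂ]

theorem lintegral_norm_sq_fourierInv {f : ℝ → ℂ} (h1 : Integrable f) (h2 : MemLp f 2) :
    ∫⁻ t, ENNReal.ofReal (‖𝓕⁻ f t‖ ^ 2) = ∫⁻ t, ENNReal.ofReal (‖f t‖ ^ 2) := by
  rw [(memLp_fourierInv h1 h2).lintegral_norm_sq, toLp_fourierInv h1 h2, h2.lintegral_norm_sq]
  congr 2
  exact (Lp.fourierTransformₗᵢ ℝ ℂ).symm.norm_map _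

/-- A square integrable function on the line that vanishes off `[-Ω, Ω]`. -/
structure IsBandSpectrum (Ω : ℝ) (φ : ℝ → ℂ) : Prop where
  memLp : MemLp φ 2
  eq_zero : ∀ w, Ω < |w| → φ w = 0

/-- The extension to the complex plane of the inverse Fourier transform of `φ`. -/
noncomputable def fourierExtension (φ : ℝ → ℂ) (z : ℂ) : ℂ :=
  ∫ w : ℝ, Complex.exp (2 * Real.pi * Complex.I * w * z) * φ w

theorem fourierExtension_ofReal (φ : ℝ → ℂ) (t : ℝ) : fourierExtension φ t = 𝓕⁻ φ t := by
  rw [Real.fourierInv_eq', fourierExtension]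
  refine integral_congr_ae (ae_of_all _ fun w => ?_)
  simp only [smul_eq_mul]
  congr 2
  simp
  ring

theorem norm_exp_two_pi_mul_le {Ω w : ℝ} (hw : |w| ≤ Ω) (z : ℂ) :
    ‖Complex.exp (2 * Real.pi * Complex.I * w * z)‖ ≤ Real.exp (2 * Real.pi * Ω * |z.im|) := by
  rw [Complex.norm_exp, Real.exp_le_exp]
  have e : (2 * Real.pi * Complex.I * w * z).re = 2 * Real.pi * (-(w * z.im)) := by
    simp
    ring
  have h : -(w * z.im) ≤ Ω * |z.im| := by
    refine (neg_le_abs _).trans ?_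
    rw [abs_mul]
    gcongr
  rw [e]
  nlinarith [Real.pi_pos]

namespace IsBandSpectrum

variable {Ω : ℝ} {φ : ℝ → ℂ}

theorem integrable (h : IsBandSpectrum Ω φ) : Integrable φ := by
  refine IntegrableOn.integrable_of_forall_notMem_eq_zero (s := Set.Icc (-Ω) Ω) ?_ fun w hw => ?_
  · exact (h.memLp.restrict _).integrable one_le_two
  · exact h.eq_zero w (by rw [Set.mem_Icc, ← abs_le] at hw; exact not_le.1 hw)

theorem mul_continuous (h : IsBandSpectrum Ω φ) {p : ℝ → ℂ} (hp : Continuous p) :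
    IsBandSpectrum Ω fun w => p w * φ w := by
  obtain ⟨C, hC⟩ := (isCompact_Icc (a := -Ω) (b := Ω)).exists_bound_of_continuousOn hp.continuousOn
  refine ⟨h.memLp.of_le_mul (c := C) (hp.aestronglyMeasurable.mul h.memLp.1)
    (ae_of_all _ fun w => ?_), fun w hw => by rw [h.eq_zero w hw, mul_zero]⟩
  rw [norm_mul]
  by_cases hw : |w| ≤ Ω
  · gcongr
    exact hC w (abs_le.1 hw)
  · simp [h.eq_zero w (not_le.1 hw)]

/-- The easy half of Paley–Wiener: a spectrum in `[-Ω, Ω]` gives exponential type `2πΩ`, which is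
`σ` when `Ω = σ/(2π)`. -/
theorem norm_fourierExtension_le (h : IsBandSpectrum Ω φ) (z : ℂ) :
    ‖fourierExtension φ z‖ ≤ (∫ w, ‖φ w‖) * Real.exp (2 * Real.pi * Ω * |z.im|) := by
  rw [fourierExtension, mul_comm (∫ w, ‖φ w‖), ← integral_const_mul]
  refine norm_integral_le_of_norm_le (h.integrable.norm.const_mul _) (ae_of_all _ fun w => ?_)
  rw [norm_mul]
  by_cases hw : |w| ≤ Ω
  · gcongr
    exact norm_exp_two_pi_mul_le hw z
  · simp [h.eq_zero w (not_le.1 hw)]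

theorem hasDerivAt_fourierExtension (h : IsBandSpectrum Ω φ) (z : ℂ) :
    HasDerivAt (fourierExtension φ)
      (fourierExtension (fun w => 2 * Real.pi * Complex.I * w * φ w) z) z := by
  have hd : IsBandSpectrum Ω fun w => 2 * Real.pi * Complex.I * w * φ w :=
    h.mul_continuous (by fun_prop)
  have hmeas : ∀ z : ℂ, Continuous fun w : ℝ => Complex.exp (2 * Real.pi * Complex.I * w * z) :=
    fun z => by fun_prop
  refine (hasDerivAt_integral_of_dominated_loc_of_deriv_le
    (F := fun z w => Complex.exp (2 * Real.pi * Complex.I * w * z) * φ w)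
    (F' := fun z w => Complex.exp (2 * Real.pi * Complex.I * w * z) *
      (2 * Real.pi * Complex.I * w * φ w))
    (bound := fun w => Real.exp (2 * Real.pi * |Ω| * (|z.im| + 1)) *
      ‖2 * Real.pi * Complex.I * w * φ w‖)
    (Metric.ball_mem_nhds z one_pos) (Filter.Eventually.of_forall fun z' =>
      (hmeas z').aestronglyMeasurable.mul h.memLp.1) (h.mul_continuous (hmeas z)).integrable
    ((hmeas z).aestronglyMeasurable.mul hd.memLp.1)
    (ae_of_all _ fun w z' hz' => ?_) (hd.integrable.norm.const_mul _)
    (ae_of_all _ fun w z' _ => ?_)).2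
  · rw [norm_mul]
    by_cases hw : |w| ≤ Ω
    · have him : |z'.im| ≤ |z.im| + 1 := by
        have h1 : |(z' - z).im| ≤ 1 :=
          (Complex.abs_im_le_norm _).trans (mem_ball_iff_norm.1 hz').le
        rw [Complex.sub_im] at h1
        linarith [abs_sub_abs_le_abs_sub z'.im z.im]
      gcongr
      refine (norm_exp_two_pi_mul_le (hw.trans (le_abs_self Ω)) z').trans ?_
      gcongr
    · simp [h.eq_zero w (not_le.1 hw)]
  · have := (((hasDerivAt_id z').const_mul (2 * Real.pi * Complex.I * w : ℂ)).cexp).mul_const (φ w)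
    refine this.congr_deriv ?_
    simp only [id, mul_one]
    ring

theorem differentiable_fourierExtension (h : IsBandSpectrum Ω φ) :
    Differentiable ℂ (fourierExtension φ) :=
  fun z => (h.hasDerivAt_fourierExtension z).differentiableAt

theorem pow_mul (h : IsBandSpectrum Ω φ) (l : ℕ) :
    IsBandSpectrum Ω fun w => (2 * Real.pi * Complex.I * w) ^ l * φ w :=
  h.mul_continuous (by fun_prop)

theorem hasDerivAt_fourierExtension_pow_mul (h : IsBandSpectrum Ω φ) (l : ℕ) (z : ℂ) :
    HasDerivAt (fourierExtension fun w => (2 * Real.pi * Complex.I * w) ^ l * φ w)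
      (fourierExtension (fun w => (2 * Real.pi * Complex.I * w) ^ (l + 1) * φ w) z) z := by
  simpa only [← mul_assoc, ← pow_succ'] using (h.pow_mul l).hasDerivAt_fourierExtension z

theorem iteratedDeriv_fourierExtension (h : IsBandSpectrum Ω φ) (l : ℕ) :
    iteratedDeriv l (fourierExtension φ) =
      fourierExtension fun w => (2 * Real.pi * Complex.I * w) ^ l * φ w := by
  induction l with
  | zero => simp [iteratedDeriv_zero]
  | succ l ih =>
    rw [iteratedDeriv_succ, ih]
    exact funext fun z => (h.hasDerivAt_fourierExtension_pow_mul l z).deriv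

theorem iteratedDeriv_fourierExtension_ofReal (h : IsBandSpectrum Ω φ) (l : ℕ) :
    iteratedDeriv l (fun t : ℝ => fourierExtension φ t) = fun t : ℝ =>
      fourierExtension (fun w => (2 * Real.pi * Complex.I * w) ^ l * φ w) t := by
  induction l with
  | zero => simp [iteratedDeriv_zero]
  | succ l ih =>
    rw [iteratedDeriv_succ, ih]
    exact funext fun t => (h.hasDerivAt_fourierExtension_pow_mul l t).comp_ofReal.deriv

theorem contDiff_fourierExtension_ofReal (h : IsBandSpectrum Ω φ) :
    ContDiff ℝ ∞ fun t : ℝ => fourierExtension φ t :=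
  (h.differentiable_fourierExtension.contDiff.restrict_scalars ℝ).comp Complex.ofRealCLM.contDiff

theorem lintegral_norm_sq_fourierExtension (h : IsBandSpectrum Ω φ) :
    ∫⁻ t : ℝ, ENNReal.ofReal (‖fourierExtension φ t‖ ^ 2) =
      ∫⁻ w, ENNReal.ofReal (‖φ w‖ ^ 2) := by
  simp only [fourierExtension_ofReal]
  exact lintegral_norm_sq_fourierInv h.integrable h.memLp

/-- Bernstein's inequality in `L²`, on the Fourier side. -/
theorem lintegral_norm_sq_pow_mul_le (h : IsBandSpectrum Ω φ) (l : ℕ) :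
    ∫⁻ w : ℝ, ENNReal.ofReal (‖(2 * Real.pi * Complex.I * w) ^ l * φ w‖ ^ 2) ≤
      ENNReal.ofReal ((2 * Real.pi * Ω) ^ (2 * l)) * ∫⁻ w, ENNReal.ofReal (‖φ w‖ ^ 2) := by
  rw [← lintegral_const_mul' _ _ ENNReal.ofReal_ne_top]
  refine lintegral_mono fun w => ?_
  rw [← ENNReal.ofReal_mul (by rw [_root_.pow_mul]; positivity)]
  refine ENNReal.ofReal_le_ofReal ?_
  by_cases hw : |w| ≤ Ω
  · have e : ‖(2 * Real.pi * Complex.I * w : ℂ)‖ = 2 * Real.pi * |w| := by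
      simp [abs_of_pos Real.pi_pos]
    rw [norm_mul, norm_pow, e, mul_pow, ← _root_.pow_mul, mul_comm l 2]
    gcongr
  · simp [h.eq_zero w (not_le.1 hw)]

theorem tsum_norm_sq_iteratedDeriv_le (h : IsBandSpectrum Ω φ) {γ : ℝ} (hγ : 0 < γ) {x : ℤ → ℝ}
    (hx : SeparatedBy γ x) (l : ℕ) :
    ∑' i, ENNReal.ofReal (‖iteratedDeriv l (fourierExtension φ) (x i : ℂ)‖ ^ 2) ≤
      ENNReal.ofReal (γ⁻¹ * (2 * (2 * Real.pi * Ω) ^ (2 * l) +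
        2 * γ ^ 2 * (2 * Real.pi * Ω) ^ (2 * (l + 1)))) * ∫⁻ w, ENNReal.ofReal (‖φ w‖ ^ 2) := by
  rw [h.iteratedDeriv_fourierExtension]
  have hcont : Continuous fun t : ℝ =>
      fourierExtension (fun w => (2 * Real.pi * Complex.I * w) ^ (l + 1) * φ w) t :=
    (h.pow_mul (l + 1)).contDiff_fourierExtension_ofReal.continuous
  have hmeas : Measurable fun t : ℝ => ENNReal.ofReal 2 * ENNReal.ofReal
      (‖fourierExtension (fun w => (2 * Real.pi * Complex.I * w) ^ l * φ w) t‖ ^ 2) :=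
    (ENNReal.continuous_ofReal.comp
      ((h.pow_mul l).contDiff_fourierExtension_ofReal.continuous.norm.pow 2)).measurable.const_mul _
  have hpow : ∀ m : ℕ, 0 ≤ (2 * Real.pi * Ω) ^ (2 * m) := fun m => by
    rw [_root_.pow_mul]; positivity
  refine (tsum_norm_sq_le_lintegral
    (fun t => (h.hasDerivAt_fourierExtension_pow_mul l t).comp_ofReal) hcont hγ hx).trans ?_
  have e : ∀ t : ℝ, ENNReal.ofReal
      (2 * ‖fourierExtension (fun w => (2 * Real.pi * Complex.I * w) ^ l * φ w) t‖ ^ 2 +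
      2 * γ ^ 2 *
        ‖fourierExtension (fun w => (2 * Real.pi * Complex.I * w) ^ (l + 1) * φ w) t‖ ^ 2) =
      ENNReal.ofReal 2 * ENNReal.ofReal
        (‖fourierExtension (fun w => (2 * Real.pi * Complex.I * w) ^ l * φ w) t‖ ^ 2) +
      ENNReal.ofReal (2 * γ ^ 2) * ENNReal.ofReal
        (‖fourierExtension (fun w => (2 * Real.pi * Complex.I * w) ^ (l + 1) * φ w) t‖ ^ 2) := by
    intro t
    rw [← ENNReal.ofReal_mul (by positivity), ← ENNReal.ofReal_mul (by positivity),
      ENNReal.ofReal_add (by positivity) (by positivity)]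
  simp only [e]
  rw [lintegral_add_left hmeas, lintegral_const_mul' _ _ ENNReal.ofReal_ne_top,
    lintegral_const_mul' _ _ ENNReal.ofReal_ne_top,
    (h.pow_mul l).lintegral_norm_sq_fourierExtension,
    (h.pow_mul (l + 1)).lintegral_norm_sq_fourierExtension,
    ENNReal.ofReal_mul (p := γ⁻¹) (by positivity), mul_assoc (ENNReal.ofReal γ⁻¹)]
  refine mul_le_mul_right ?_ _
  rw [ENNReal.ofReal_add (mul_nonneg zero_le_two (hpow l)) (mul_nonneg (by positivity) (hpow _)),
    add_mul, ENNReal.ofReal_mul (q := (2 * Real.pi * Ω) ^ (2 * l)) zero_le_two,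
    ENNReal.ofReal_mul (by positivity : 0 ≤ 2 * γ ^ 2), mul_assoc (ENNReal.ofReal 2),
    mul_assoc (ENNReal.ofReal (2 * γ ^ 2))]
  exact add_le_add (mul_le_mul_right (h.lintegral_norm_sq_pow_mul_le l) _)
    (mul_le_mul_right (h.lintegral_norm_sq_pow_mul_le (l + 1)) _)

end IsBandSpectrum

/-- Since `g` is integrable, `𝓕 g` is continuous; the set off the band where it is nonzero is open
and null, hence empty. -/
theorem isBandSpectrum_fourier {σ : ℝ} {g : ℝ → ℂ} (hg2 : MemLp g 2 (volume : Measure ℝ))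
    (hg1 : Integrable g) (hband : hg2.toLp g ∈ bandlimited σ) : IsBandSpectrum (σ / (2 * Real.pi)) (𝓕 g) := by
  have hae := coeFn_fourier_toLp hg1 hg2
  refine ⟨(Lp.memLp _).ae_eq hae, fun w hw => ?_⟩
  by_contra hne
  have hcont : Continuous (𝓕 g) := VectorFourier.fourierIntegral_continuous
    Real.continuous_fourierChar continuous_inner hg1
  have hopen : IsOpen {w : ℝ | σ / (2 * Real.pi) < |w| ∧ 𝓕 g w ≠ 0} :=
    (isOpen_lt continuous_const continuous_abs).inter (isOpen_ne_fun hcont continuous_const)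
  refine (hopen.measure_pos volume ⟨w, hw, hne⟩).ne' ?_
  refine measure_eq_zero_iff_ae_notMem.2 ?_
  filter_upwards [hband, hae] with v hv hv' hmem
  refine hmem.2 (hv' ▸ hv fun hI => ?_)
  exact hmem.1.not_ge (abs_le.2 hI)

/-! ### Frame coefficients as samples of band-limited functions. -/

theorem IsBandSpectrum.conj_mul_comp_add {Ω : ℝ} {ψ F : ℝ → ℂ} (h : IsBandSpectrum Ω ψ)
    (hψ : Continuous ψ) (hF : MemLp F 2) (y : ℝ) :
    IsBandSpectrum Ω fun w => starRingEnd ℂ (ψ w) * F (w + y) := by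
  obtain ⟨C, hC⟩ := (isCompact_Icc (a := -Ω) (b := Ω)).exists_bound_of_continuousOn hψ.continuousOn
  have hF' : MemLp (fun w => F (w + y)) 2 :=
    hF.comp_measurePreserving (measurePreserving_add_right volume y)
  refine ⟨hF'.of_le_mul (c := |C|)
    ((Complex.continuous_conj.comp hψ).aestronglyMeasurable.mul hF'.1)
    (ae_of_all _ fun w => ?_), fun w hw => by rw [h.eq_zero w hw, map_zero, zero_mul]⟩
  have hC0 : ‖ψ w‖ ≤ |C| := by
    by_cases hw : |w| ≤ Ω
    · exact (hC w (abs_le.1 hw)).trans (le_abs_self C)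
    · simp [h.eq_zero w (not_le.1 hw)]
  rw [norm_mul, RCLike.norm_conj]
  gcongr

theorem IsBandSpectrum.memLp_comp_sub {Ω : ℝ} {η : ℝ → ℂ} (h : IsBandSpectrum Ω η) (x y : ℝ) :
    Integrable (fun v : ℝ => Complex.exp (-(2 * Real.pi * Complex.I * (v - y) * x)) * η (v - y)) ∧
      MemLp (fun v : ℝ => Complex.exp (-(2 * Real.pi * Complex.I * (v - y) * x)) * η (v - y)) 2 := by
  have h' : IsBandSpectrum Ω
      fun w : ℝ => Complex.exp (-(2 * Real.pi * Complex.I * w * x)) * η w :=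
    h.mul_continuous (by fun_prop)
  refine ⟨?_, ?_⟩
  · simpa using h'.integrable.comp_sub_right y
  · simpa [Function.comp_def] using
      h'.memLp.comp_measurePreserving (measurePreserving_sub_right volume y)

theorem modulation_translation_fourierExtension (η : ℝ → ℂ) (x y : ℝ) :
    modulation y (translation x fun t => fourierExtension η t) =
      𝓕⁻ fun v : ℝ => Complex.exp (-(2 * Real.pi * Complex.I * (v - y) * x)) * η (v - y) := by
  funext t
  rw [← fourierExtension_ofReal, modulation, translation, fourierExtension, fourierExtension,
    ← integral_const_mul, ← integral_sub_right_eq_self _ y]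
  refine integral_congr_ae (ae_of_all _ fun v => ?_)
  simp only [← mul_assoc, ← Complex.exp_add]
  congr 2
  push_cast
  ring

/-- Parseval: on the Fourier side the atom is a shift of `η` by `y` carrying the phase of `x`, and
conjugating that phase produces the evaluation at `x`. -/
theorem IsBandSpectrum.inner_modulation_translation {Ω : ℝ} {η : ℝ → ℂ} (h : IsBandSpectrum Ω η)
    {x y : ℝ} (he : MemLp (modulation y (translation x fun t => fourierExtension η t)) 2)
    (f : Lp ℂ 2 (volume : Measure ℝ)) :
    inner ℂ (he.toLp _) f = fourierExtension
      (fun w => starRingEnd ℂ (η w) * (𝓕 f : Lp ℂ 2 (volume : Measure ℝ)) (w + y)) x := by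
  obtain ⟨h1, h2⟩ := h.memLp_comp_sub x y
  have key : he.toLp _ = (𝓕⁻ (h2.toLp _) : Lp ℂ 2 (volume : Measure ℝ)) := by
    rw [← toLp_fourierInv h1 h2 (memLp_fourierInv h1 h2)]
    exact MemLp.toLp_congr _ _ (ae_of_all _ fun t => by
      rw [modulation_translation_fourierExtension])
  rw [key, ← Lp.inner_fourier_eq, FourierTransform.fourier_fourierInv_eq, L2.inner_def,
    fourierExtension]
  refine Eq.trans (integral_congr_ae ?_) (integral_sub_right_eq_self _ y)
  filter_upwards [h2.coeFn_toLp] with v hv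
  rw [hv, RCLike.inner_apply, map_mul, ← Complex.exp_conj, sub_add_cancel]
  rw [mul_comm, mul_assoc]
  congr 2
  simp [map_ofNat]

/-- The multiplier `(2πiw)^l` is changed by conjugation only by the sign `(-1)^l`, so derivatives
pass from the window to the sampled function. -/
theorem IsBandSpectrum.norm_inner_modulation_translation {Ω : ℝ} {ψ : ℝ → ℂ}
    (h : IsBandSpectrum Ω ψ) (hψ : Continuous ψ) (l : ℕ) {x y : ℝ}
    (he : MemLp (modulation y (translation x
      (iteratedDeriv l fun t : ℝ => fourierExtension ψ t))) 2)
    (f : Lp ℂ 2 (volume : Measure ℝ)) :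
    ‖inner ℂ (he.toLp _) f‖ = ‖iteratedDeriv l (fourierExtension fun w =>
      starRingEnd ℂ (ψ w) * (𝓕 f : Lp ℂ 2 (volume : Measure ℝ)) (w + y)) x‖ := by
  have hφ := h.conj_mul_comp_add hψ (Lp.memLp (𝓕 f : Lp ℂ 2 (volume : Measure ℝ))) y
  simp only [h.iteratedDeriv_fourierExtension_ofReal] at he ⊢
  rw [(h.pow_mul l).inner_modulation_translation he f, hφ.iteratedDeriv_fourierExtension]
  have e : fourierExtension (fun w => starRingEnd ℂ ((2 * Real.pi * Complex.I * w) ^ l * ψ w) *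
      (𝓕 f : Lp ℂ 2 (volume : Measure ℝ)) (w + y)) x = (-1) ^ l * fourierExtension (fun w =>
      (2 * Real.pi * Complex.I * w) ^ l * (starRingEnd ℂ (ψ w) *
      (𝓕 f : Lp ℂ 2 (volume : Measure ℝ)) (w + y))) x := by
    rw [fourierExtension, fourierExtension, ← integral_const_mul]
    refine integral_congr_ae (ae_of_all _ fun w => ?_)
    have : starRingEnd ℂ (2 * Real.pi * Complex.I * w) = -1 * (2 * Real.pi * Complex.I * w) := by
      simp [map_ofNat]
    simp only [map_mul (starRingEnd ℂ) (_ ^ l), map_pow, this, mul_pow (-1 : ℂ)]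
    ring
  rw [e, norm_mul, norm_pow, norm_neg, norm_one, one_pow, one_mul]

theorem tsum_lintegral_conj_mul_comp_add {ψ F : ℝ → ℂ} (hψ : Continuous ψ)
    (hF : AEStronglyMeasurable F) (y : ℤ → ℝ) :
    ∑' j, ∫⁻ w, ENNReal.ofReal (‖starRingEnd ℂ (ψ w) * F (w + y j)‖ ^ 2) =
      ∫⁻ v, (∑' j, ENNReal.ofReal (‖ψ (v - y j)‖ ^ 2)) * ENNReal.ofReal (‖F v‖ ^ 2) := by
  simp only [← ENNReal.tsum_mul_right]
  rw [lintegral_tsum fun j => ?_]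
  · refine tsum_congr fun j => ?_
    rw [← lintegral_sub_right_eq_self _ (y j)]
    refine lintegral_congr fun v => ?_
    rw [sub_add_cancel, norm_mul, RCLike.norm_conj, mul_pow, ENNReal.ofReal_mul (by positivity)]
  · have : Continuous fun v => ‖ψ (v - y j)‖ ^ 2 := by fun_prop
    exact this.measurable.ennreal_ofReal.aemeasurable.mul
      (hF.norm.aemeasurable.pow_const 2).ennreal_ofReal

/-- By Tonelli and translation the sum over `j` is `∫ (∑_j |ψ(v - y_j)|²) |f̂(v)|² dv`; the
hypothesis bounds the weight, and Plancherel identifies the rest with `‖f‖²`. -/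
theorem tsum_lintegral_conj_mul_comp_add_bounds {ψ : ℝ → ℂ} (hψ : Continuous ψ) {a b : ℝ}
    (ha : 0 ≤ a) (hb : 0 ≤ b) {y : ℤ → ℝ}
    (hy : ∀ ξ : ℝ, Summable (fun j : ℤ => ‖ψ (ξ - y j)‖ ^ 2) ∧
      a ≤ ∑' j : ℤ, ‖ψ (ξ - y j)‖ ^ 2 ∧ ∑' j : ℤ, ‖ψ (ξ - y j)‖ ^ 2 ≤ b)
    (f : Lp ℂ 2 (volume : Measure ℝ)) :
    ENNReal.ofReal (a * ‖f‖ ^ 2) ≤ ∑' j, ∫⁻ w, ENNReal.ofReal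
        (‖starRingEnd ℂ (ψ w) * (𝓕 f : Lp ℂ 2 (volume : Measure ℝ)) (w + y j)‖ ^ 2) ∧
      ∑' j, ∫⁻ w, ENNReal.ofReal
        (‖starRingEnd ℂ (ψ w) * (𝓕 f : Lp ℂ 2 (volume : Measure ℝ)) (w + y j)‖ ^ 2) ≤
        ENNReal.ofReal (b * ‖f‖ ^ 2) := by
  have hF := Lp.memLp (𝓕 f : Lp ℂ 2 (volume : Measure ℝ))
  have hn : ENNReal.ofReal (‖f‖ ^ 2) =
      ∫⁻ v, ENNReal.ofReal (‖(𝓕 f : Lp ℂ 2 (volume : Measure ℝ)) v‖ ^ 2) := by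
    rw [hF.lintegral_norm_sq, Lp.toLp_coeFn, Lp.norm_fourier_eq]
  rw [tsum_lintegral_conj_mul_comp_add hψ hF.1, ENNReal.ofReal_mul ha, ENNReal.ofReal_mul hb, hn,
    ← lintegral_const_mul' _ _ ENNReal.ofReal_ne_top,
    ← lintegral_const_mul' _ _ ENNReal.ofReal_ne_top]
  have hs : ∀ v, ∑' j, ENNReal.ofReal (‖ψ (v - y j)‖ ^ 2) =
      ENNReal.ofReal (∑' j, ‖ψ (v - y j)‖ ^ 2) := fun v =>
    (ENNReal.ofReal_tsum_of_nonneg (fun _ => by positivity) (hy v).1).symm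
  simp only [hs]
  refine ⟨lintegral_mono fun v => ?_, lintegral_mono fun v => ?_⟩
  · exact mul_le_mul_left (ENNReal.ofReal_le_ofReal (hy v).2.1) _
  · exact mul_le_mul_left (ENNReal.ofReal_le_ofReal (hy v).2.2) _

theorem isFrame_of_tsum_ofReal_bounds {ι H : Type*} [NormedAddCommGroup H] [InnerProductSpace ℂ H]
    {F : ι → H} {m M : ℝ} (hm : 0 < m)
    (h : ∀ f, ENNReal.ofReal (m * ‖f‖ ^ 2) ≤ ∑' n, ENNReal.ofReal (‖(inner ℂ (F n) f : ℂ)‖ ^ 2))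
    (h' : ∀ f, ∑' n, ENNReal.ofReal (‖(inner ℂ (F n) f : ℂ)‖ ^ 2) ≤ ENNReal.ofReal (M * ‖f‖ ^ 2)) :
    IsFrame F := by
  refine ⟨m, max m M, hm, le_max_left _ _, fun f => ?_⟩
  have hs : Summable fun n => ‖(inner ℂ (F n) f : ℂ)‖ ^ 2 := by
    have := ENNReal.summable_toReal ((h' f).trans_lt ENNReal.ofReal_lt_top).ne
    simpa using this
  have hT := ENNReal.ofReal_tsum_of_nonneg (fun n => by positivity) hs
  have h1 := h f
  have h2 := (h' f).trans (ENNReal.ofReal_le_ofReal (q := max m M * ‖f‖ ^ 2)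
    (mul_le_mul_of_nonneg_right (le_max_right _ _) (by positivity)))
  have hM : 0 ≤ max m M := hm.le.trans (le_max_left _ _)
  rw [← hT] at h1 h2
  exact ⟨hs, (ENNReal.ofReal_le_ofReal_iff (tsum_nonneg fun _ => by positivity)).1 h1,
    (ENNReal.ofReal_le_ofReal_iff (by positivity)).1 h2⟩

theorem ENNReal.tsum_fin_prod (k : ℕ) (G : ℕ → ℤ → ℤ → ENNReal) :
    ∑' p : Fin k × ℤ × ℤ, G p.1 p.2.1 p.2.2 = ∑' j, ∑ l ∈ Finset.range k, ∑' i, G l i j := by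
  rw [ENNReal.tsum_prod', tsum_fintype]
  simp only [ENNReal.tsum_prod']
  rw [Fin.sum_univ_eq_sum_range (fun l => ∑' i, ∑' j, G l i j)]
  rw [Summable.tsum_finsetSum fun _ _ => ENNReal.summable]
  exact Finset.sum_congr rfl fun l _ => ENNReal.tsum_comm

theorem isFrame_modulation_translation {Ω : ℝ} (hΩ : 0 ≤ Ω) {ψ : ℝ → ℂ} (h : IsBandSpectrum Ω ψ)
    (hψ : Continuous ψ) {a b : ℝ} (ha : 0 < a) (hb : 0 ≤ b) {y : ℤ → ℝ}
    (hy : ∀ ξ : ℝ, Summable (fun j : ℤ => ‖ψ (ξ - y j)‖ ^ 2) ∧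
      a ≤ ∑' j : ℤ, ‖ψ (ξ - y j)‖ ^ 2 ∧ ∑' j : ℤ, ‖ψ (ξ - y j)‖ ^ 2 ≤ b)
    {k ν : ℕ} (hk : 1 ≤ k) (hν : 1 ≤ ν) {γ δ : ℝ} (hγ : 0 < γ) (hδ : 0 < δ)
    (hdens : 2 * Real.pi * Ω * δ < k * ν * Real.pi) {x : ℤ → ℤ → ℝ}
    (hxmono : ∀ j, StrictMono fun i => x i j) (hxsep : ∀ j, SeparatedBy γ fun i => x i j)
    (hxgap : ∀ i j, x (i + ν) j - x i j ≤ δ)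
    (hL2 : ∀ p : Fin k × ℤ × ℤ, MemLp (modulation (y p.2.2) (translation (x p.2.1 p.2.2)
      (iteratedDeriv (p.1 : ℕ) fun t : ℝ => fourierExtension ψ t))) 2 (volume : Measure ℝ)) :
    IsFrame fun p : Fin k × ℤ × ℤ => (hL2 p).toLp (modulation (y p.2.2)
      (translation (x p.2.1 p.2.2)
        (iteratedDeriv (p.1 : ℕ) fun t : ℝ => fourierExtension ψ t))) := by
  -- One `K` serves every `j`, because the sampling constant does not depend on the node sequence;
  -- this is what permits summation over `j`.
  obtain ⟨K, hK, hlow⟩ := exists_lintegral_le_tsum_sampling (by positivity) hγ hδ hν hk hdens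
  set B : ℕ → ℝ := fun l => γ⁻¹ * (2 * (2 * Real.pi * Ω) ^ (2 * l) +
    2 * γ ^ 2 * (2 * Real.pi * Ω) ^ (2 * (l + 1))) with hB
  have hB0 : ∀ l, 0 ≤ B l := fun l => by positivity
  have hsum : ∀ f : Lp ℂ 2 (volume : Measure ℝ), ∑' p : Fin k × ℤ × ℤ, ENNReal.ofReal
      (‖(inner ℂ ((hL2 p).toLp (modulation (y p.2.2) (translation (x p.2.1 p.2.2)
        (iteratedDeriv (p.1 : ℕ) fun t : ℝ => fourierExtension ψ t)))) f : ℂ)‖ ^ 2) =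
      ∑' j, ∑ l ∈ Finset.range k, ∑' i, ENNReal.ofReal (‖iteratedDeriv l (fourierExtension fun w =>
        starRingEnd ℂ (ψ w) * (𝓕 f : Lp ℂ 2 (volume : Measure ℝ)) (w + y j)) (x i j)‖ ^ 2) := by
    intro f
    rw [← ENNReal.tsum_fin_prod k fun l i j => ENNReal.ofReal (‖iteratedDeriv l (fourierExtension
      fun w => starRingEnd ℂ (ψ w) * (𝓕 f : Lp ℂ 2 (volume : Measure ℝ)) (w + y j)) (x i j)‖ ^ 2)]
    exact tsum_congr fun p => by rw [h.norm_inner_modulation_translation hψ]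
  have hφ : ∀ (f : Lp ℂ 2 (volume : Measure ℝ)) (j : ℤ), IsBandSpectrum Ω fun w =>
      starRingEnd ℂ (ψ w) * (𝓕 f : Lp ℂ 2 (volume : Measure ℝ)) (w + y j) := fun f j =>
    h.conj_mul_comp_add hψ (Lp.memLp _) (y j)
  refine isFrame_of_tsum_ofReal_bounds (m := a / K) (M := (∑ l ∈ Finset.range k, B l) * b)
    (div_pos ha hK) (fun f => ?_) fun f => ?_
  · rw [hsum f, div_mul_eq_mul_div, ENNReal.ofReal_div_of_pos hK]
    refine ENNReal.div_le_of_le_mul' ?_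
    refine (tsum_lintegral_conj_mul_comp_add_bounds hψ ha.le hb hy f).1.trans ?_
    rw [← ENNReal.tsum_mul_left]
    refine ENNReal.tsum_le_tsum fun j => ?_
    rw [← (hφ f j).lintegral_norm_sq_fourierExtension,
      ← Summable.tsum_finsetSum fun _ _ => ENNReal.summable]
    simp only [← ENNReal.ofReal_sum_of_nonneg fun _ _ => sq_nonneg _]
    exact hlow _ _ (fun i => x i j) (hφ f j).differentiable_fourierExtension
      (hφ f j).norm_fourierExtension_le (hxmono j) (hxsep j) fun i => hxgap i j
  · rw [hsum f, mul_assoc, ENNReal.ofReal_mul (Finset.sum_nonneg fun l _ => hB0 l),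
      ENNReal.ofReal_sum_of_nonneg fun l _ => hB0 l]
    refine le_trans ?_ (mul_le_mul_right
      (tsum_lintegral_conj_mul_comp_add_bounds hψ ha.le hb hy f).2 _)
    rw [← ENNReal.tsum_mul_left]
    refine ENNReal.tsum_le_tsum fun j => ?_
    rw [Finset.sum_mul]
    exact Finset.sum_le_sum fun l _ => (hφ f j).tsum_norm_sq_iteratedDeriv_le hγ (hxsep j) l

/-- `g` is a function in `B_σ ∩ L¹`; continuity only says that `g` is the smooth representative of
its class in `L²`, the one whose derivatives `g^(l)` are meant. -/
theorem theorem3p4 (σ : ℝ) (hσ : 0 < σ) (k : ℕ) (hk : 1 ≤ k) (ν : ℕ) (hν : 1 ≤ ν)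
    (g : ℝ → ℂ) (hgcont : Continuous g)
    (hg2 : MemLp g 2 (volume : Measure ℝ)) (hgband : hg2.toLp g ∈ bandlimited σ)
    (hg1 : Integrable g (volume : Measure ℝ))
    (y : ℤ → ℝ) (a b : ℝ) (ha : 0 < a) (hb : 0 < b)
    (hy : ∀ ξ : ℝ, Summable (fun j : ℤ => ‖𝓕 g (ξ - y j)‖ ^ 2) ∧
      a ≤ ∑' j : ℤ, ‖𝓕 g (ξ - y j)‖ ^ 2 ∧ ∑' j : ℤ, ‖𝓕 g (ξ - y j)‖ ^ 2 ≤ b)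
    (x : ℤ → ℤ → ℝ) (hxmono : ∀ j : ℤ, StrictMono (fun i : ℤ => x i j))
    (γ : ℝ) (hγ : 0 < γ) (hxsep : ∀ j : ℤ, SeparatedBy γ (fun i : ℤ => x i j))
    (δ : ℝ) (hxgap : ∀ i j : ℤ, x (i + ν) j - x i j ≤ δ)
    (hδ : δ < (ν : ℝ) / σ * wirtingerConstant k ^ (1 / (2 * (k : ℝ)))) :
    ContDiff ℝ ∞ g ∧
    ∃ hL2 : ∀ p : Fin k × ℤ × ℤ,
        MemLp (modulation (y p.2.2) (translation (x p.2.1 p.2.2) (iteratedDeriv (p.1 : ℕ) g))) 2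
          (volume : Measure ℝ),
      IsFrame (fun p : Fin k × ℤ × ℤ => (hL2 p).toLp
        (modulation (y p.2.2) (translation (x p.2.1 p.2.2) (iteratedDeriv (p.1 : ℕ) g)))) := by
  have hcont : Continuous (𝓕 g) := VectorFourier.fourierIntegral_continuous
    Real.continuous_fourierChar continuous_inner hg1
  have hψ := isBandSpectrum_fourier hg2 hg1 hgband
  -- Fourier inversion holds at every point since `g` is continuous and both `g` and `𝓕 g` are
  -- integrable; smoothness of `g` follows.
  have hg : g = fun t : ℝ => fourierExtension (𝓕 g) t := by
    funext t
    rw [fourierExtension_ofReal, hgcont.fourierInv_fourier_eq hg1 hψ.integrable]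
  generalize 𝓕 g = ψ at *
  subst hg
  have hν0 : (0 : ℝ) < ν := by exact_mod_cast hν
  -- Positivity of `δ` is not assumed; it is forced by strict monotonicity over one gap.
  have hδ0 : 0 < δ := (sub_pos.2 (hxmono 0 (by omega : (0 : ℤ) < 0 + ν))).trans_le (hxgap 0 0)
  -- The bound `c_k ^ (1/(2k)) ≤ kπ` converts the Wirtinger condition into the critical density
  -- condition `σ δ < k ν π`.
  have hdens : 2 * Real.pi * (σ / (2 * Real.pi)) * δ < k * ν * Real.pi := by
    have h1 := hδ.trans_le (mul_le_mul_of_nonneg_left (wirtingerConstant_rpow_le hk)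
      (div_nonneg hν0.le hσ.le))
    rw [mul_div_cancel₀ _ (by positivity)]
    calc σ * δ < σ * (ν / σ * (k * Real.pi)) := mul_lt_mul_of_pos_left h1 hσ
      _ = k * ν * Real.pi := by field_simp
  have hL2 : ∀ p : Fin k × ℤ × ℤ, MemLp (modulation (y p.2.2) (translation (x p.2.1 p.2.2)
      (iteratedDeriv (p.1 : ℕ) fun t : ℝ => fourierExtension ψ t))) 2 (volume : Measure ℝ) := by
    intro p
    rw [hψ.iteratedDeriv_fourierExtension_ofReal, modulation_translation_fourierExtension]
    obtain ⟨h1, h2⟩ := (hψ.pow_mul p.1).memLp_comp_sub (x p.2.1 p.2.2) (y p.2.2)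
    exact memLp_fourierInv h1 h2
  exact ⟨hψ.contDiff_fourierExtension_ofReal, hL2, isFrame_modulation_translation (by positivity)
    hψ hcont ha hb.le hy hk hν hγ hδ0 hdens hxmono hxsep hxgap hL2⟩
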